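/- Let $r\ge 1$, let $n_1>n_2>\dots>n_s>0$ and $p_1,\dots,p_s\ge 1$ be integers, and put $N=r\sum_{i=1}^s p_in_i$, so that $\lambda=(n_1,\dots,n_1,\dots,n_s,\dots,n_s)$, with $n_i$ repeated $p_i$ times, is a partition of $N/r$. For a positive integer $p$ let $J_r(p)\subset GL(pr,\mathbb C)$ be the group of all block matrices $(h_{j-i})_{0\le i,j<p}$ with $h_0\in GL(r,\mathbb C)$, $h_1,\dots,h_{p-1}\in \mathrm{Mat}(r,\mathbb C)$ and $h_k=0$ for $k<0$. For $c=(c_1,c_2,\dots)$ define $\mu_{i,j}(c)$ $(i,j\ge 0)$ by $(c_1T+c_2T^2+\cdots)^i=\sum_{j\ge0}\mu_{i,j}(c)T^j$ (the $0$-th power being $1$), and let $$W_r(p)=\{(\mu_{i,j}(c)1_r)_{0\le i,j<p}\mid c_1,\dots,c_{p-1}\in\mathbb C,\ c_1\ne0\}\subset GL(pr,\mathbb C),$$ which is a group (the entries involve only $c_1,\dots,c_{p-1}$; for $p=1$ the condition $c_1\neq 0$ is void and $W_r(1)=\{1_r\}$). Products of matrix groups are regarded as groups of block diagonal matrices. Let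 $H_\lambda=\prod_{i=1}^s J_r(n_i)^{p_i}\subset G=GL(N,\mathbb C)$, and let $\mathcal P_i$ be the group of the block permutation matrices $P_\sigma=(\delta_{j,\sigma(k)}1_{n_ir})_{1\le j,k\le p_i}$, $\sigma\in\mathfrak S_{p_i}$. (1) The normalizer of $H_\lambda$ in $G$, which equals $\{g\in G\mid ghg^{-1}\in H_\lambda \text{ for all } h\in H_\lambda\}$, is the internal semidirect product $$N_G(H_\lambda)=H_\lambda\rtimes\prod_{i=1}^s\bigl(W_r(n_i)^{p_i}\rtimes\mathcal P_i\bigr),$$ where each $W_r(n_i)^{p_i}\rtimes\mathcal P_i\subset GL(p_in_ir,\mathbb C)$ is the internal semidirect product of its normal subgroup $W_r(n_i)^{p_i}$ and $\mathcal P_i$, and $\sigma\mapsto P_\sigma$ is an isomorphism $\mathfrak S_{p_i}\to\mathcal P_i$. (2) $\mathcal P_i$ acts on $W_r(n_i)^{p_i}$ by permuting the diagonal blocks: $P_\sigma\,\mathrm{diag}(X_1,\dots,X_{p_i})\,P_\sigma^{-1}=\mathrm{diag}(X_{\sigma^{-1}(1)},\dots,X_{\sigma^{-1}(p_i)})$ for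 all $X_1,\dots,X_{p_i}\in W_r(n_i)$ and $\sigma\in\mathfrak S_{p_i}$. -/

import Mathlib

namespace JordanNormalizer

open scoped Kronecker

/-! ### Block matrices -/

section Blocks

variable {ι : Type*} [Fintype ι] [DecidableEq ι] (m : ι → Type*)
  [∀ i, Fintype (m i)] [∀ i, DecidableEq (m i)]

/-- The homomorphism `(X_i)_i ↦ diag(X_i)_i` from `∏ GL(m_i)` to the general linear group whose
rows and columns are indexed by the disjoint union of the `m_i`. -/
noncomputable def blockDiag : (∀ i, GL (m i) ℂ) →* GL (Σ i, m i) ℂ :=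
  (Units.map (Matrix.blockDiagonal'RingHom m ℂ).toMonoidHom).comp
    (MulEquiv.piUnits (M := fun i => Matrix (m i) (m i) ℂ)).symm.toMonoidHom

/-- The product `∏ K_i` of subgroups `K_i` of `GL(m_i)`, regarded as the group of all block
diagonal matrices `diag(X_i)_i` with `X_i ∈ K_i`. -/
noncomputable def blockProd {m : ι → Type*} [∀ i, Fintype (m i)] [∀ i, DecidableEq (m i)]
    (K : ∀ i, Subgroup (GL (m i) ℂ)) : Subgroup (GL (Σ i, m i) ℂ) :=
  (Subgroup.pi Set.univ K).map (blockDiag m)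

/-- The matrix `P_σ` consisting of `p × p` blocks indexed by `m × m`, whose `(j, k)`-block is
`δ_{j, σ(k)} • 1`, as a homomorphism in `σ`. -/
def blockPermMatrix (p : ℕ) (m : Type*) [Fintype m] [DecidableEq m] :
    Equiv.Perm (Fin p) →* Matrix (Σ _ : Fin p, m) (Σ _ : Fin p, m) ℂ where
  toFun σ := Matrix.of fun x y => if x.1 = σ y.1 ∧ x.2 = y.2 then 1 else 0
  map_one' := by
    ext ⟨j, a⟩ ⟨k, b⟩
    simp only [Matrix.of_apply, Matrix.one_apply, Equiv.Perm.one_apply, Sigma.mk.injEq,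
      heq_eq_eq]
    congr
  map_mul' σ τ := by
    ext ⟨j, a⟩ ⟨k, b⟩
    simp only [Matrix.of_apply, Matrix.mul_apply, Equiv.Perm.mul_apply]
    rw [Finset.sum_eq_single ⟨τ k, b⟩]
    · simp only [and_self, if_true, mul_one]
      congr
    · rintro ⟨l, c⟩ _ hne
      rw [if_neg (c := l = τ k ∧ c = b), mul_zero]
      rintro ⟨rfl, rfl⟩
      exact hne rfl
    · simp

/-- The invertible matrix `P_σ`, as a homomorphism in `σ`. -/
def blockPerm (p : ℕ) (m : Type*) [Fintype m] [DecidableEq m] :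
    Equiv.Perm (Fin p) →* GL (Σ _ : Fin p, m) ℂ :=
  (blockPermMatrix p m).toHomUnits

end Blocks

/-! ### The Jordan group -/

/-- The block upper triangular Toeplitz matrix with `p × p` blocks of size `r`, whose
`(i, j)`-block is `h_{j - i}` if `i ≤ j` and `0` otherwise. -/
def toeplitz (r p : ℕ) (h : ℕ → Matrix (Fin r) (Fin r) ℂ) :
    Matrix (Fin p × Fin r) (Fin p × Fin r) ℂ :=
  Matrix.of fun x y => if x.1 ≤ y.1 then h (y.1 - x.1 : ℕ) x.2 y.2 else 0

theorem toeplitz_one (r p : ℕ) :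
    toeplitz r p (fun k => PowerSeries.coeff k (1 : PowerSeries (Matrix (Fin r) (Fin r) ℂ)))
      = 1 := by
  ext ⟨i, a⟩ ⟨j, b⟩
  simp only [toeplitz, Matrix.of_apply, PowerSeries.coeff_one, Matrix.one_apply, Prod.mk.injEq]
  rcases lt_trichotomy i j with hij | rfl | hij
  · have h1 : (j : ℕ) - i ≠ 0 := by have : (i : ℕ) < j := hij; omega
    simp [hij.le, h1, hij.ne]
  · simp [Matrix.one_apply]
  · simp [hij.not_ge, hij.ne']

theorem toeplitz_mul (r p : ℕ) (f g : PowerSeries (Matrix (Fin r) (Fin r) ℂ)) :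
    toeplitz r p (fun k => PowerSeries.coeff k f) * toeplitz r p (fun k => PowerSeries.coeff k g)
      = toeplitz r p (fun k => PowerSeries.coeff k (f * g)) := by
  ext ⟨i, a⟩ ⟨j, b⟩
  simp only [toeplitz, Matrix.of_apply, Matrix.mul_apply, Fintype.sum_prod_type,
    PowerSeries.coeff_mul, Matrix.sum_apply]
  by_cases hij : i ≤ j
  · rw [if_pos hij]
    have hij' : (i : ℕ) ≤ j := hij
    symm
    have hsub : ∀ k : Fin p, k ∉ Finset.Icc i j →
        (∑ c, (if i ≤ k then PowerSeries.coeff ((k : ℕ) - i) f a c else 0) *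
          (if k ≤ j then PowerSeries.coeff ((j : ℕ) - k) g c b else 0)) = 0 := by
      intro k hk
      refine Finset.sum_eq_zero fun c _ => ?_
      rw [Finset.mem_Icc, not_and_or] at hk
      rcases hk with hk | hk <;> simp [hk]
    rw [← Finset.sum_subset (Finset.subset_univ (Finset.Icc i j)) (fun k _ hk => hsub k hk)]
    refine Finset.sum_bij' (fun x hx => (⟨i + x.1, by
        have := Finset.HasAntidiagonal.mem_antidiagonal.1 hx
        have := j.2
        omega⟩ : Fin p)) (fun k _ => ((k : ℕ) - i, (j : ℕ) - k)) ?_ ?_ ?_ ?_ ?_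
    · rintro ⟨u, v⟩ hx
      have := Finset.HasAntidiagonal.mem_antidiagonal.1 hx
      simp only [Finset.mem_Icc, Fin.le_def]
      omega
    · intro k hk
      simp only [Finset.mem_Icc, Fin.le_def] at hk
      rw [Finset.HasAntidiagonal.mem_antidiagonal]
      omega
    · rintro ⟨u, v⟩ hx
      have := Finset.HasAntidiagonal.mem_antidiagonal.1 hx
      ext <;> simp only <;> omega
    · intro k hk
      simp only [Finset.mem_Icc, Fin.le_def] at hk
      ext
      simp only
      omega
    · rintro ⟨u, v⟩ hx
      have := Finset.HasAntidiagonal.mem_antidiagonal.1 hx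
      refine Finset.sum_congr rfl fun c _ => ?_
      simp only at this ⊢
      rw [if_pos (by simp only [Fin.le_def]; omega), if_pos (by simp only [Fin.le_def]; omega)]
      rw [show (i : ℕ) + u - i = u by omega, show (j : ℕ) - (i + u) = v by omega]
  · rw [if_neg hij]
    refine Finset.sum_eq_zero fun k _ => Finset.sum_eq_zero fun c _ => ?_
    by_cases h1 : i ≤ k
    · have h2 : ¬ k ≤ j := fun h2 => hij (h1.trans h2)
      simp [h2]
    · simp [h1]

/-- The (generalized) Jordan group `J_r(p)`. -/
def jordanGroup (r p : ℕ) : Subgroup (GL (Fin p × Fin r) ℂ) where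
  carrier := {g | ∃ h : ℕ → Matrix (Fin r) (Fin r) ℂ, IsUnit (h 0) ∧
    (g : Matrix (Fin p × Fin r) (Fin p × Fin r) ℂ) = toeplitz r p h}
  one_mem' := ⟨fun k => PowerSeries.coeff k 1, by simp, by rw [toeplitz_one, Units.val_one]⟩
  mul_mem' := by
    rintro x y ⟨f, hf, hx⟩ ⟨g, hg, hy⟩
    refine ⟨fun k => PowerSeries.coeff k (PowerSeries.mk f * PowerSeries.mk g), ?_, ?_⟩
    · simpa [PowerSeries.coeff_mul] using hf.mul hg
    · rw [← toeplitz_mul, Units.val_mul, hx, hy]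
      simp only [PowerSeries.coeff_mk]
  inv_mem' := by
    rintro x ⟨f, ⟨u, hu⟩, hx⟩
    refine ⟨fun k => PowerSeries.coeff k (PowerSeries.invOfUnit (PowerSeries.mk f) u), ?_, ?_⟩
    · simp
    · refine Units.inv_eq_of_mul_eq_one_right ?_
      have h1 : toeplitz r p f = toeplitz r p (fun k => PowerSeries.coeff k (PowerSeries.mk f)) := by
        simp only [PowerSeries.coeff_mk]
      rw [hx, h1, toeplitz_mul, PowerSeries.mul_invOfUnit _ _ (by simp [hu]), toeplitz_one]

/-! ### The group `W_r(p)` -/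

/-- The formal power series `M(c, T) = c_1 T + c_2 T² + ⋯`. -/
noncomputable def genSeries (c : ℕ → ℂ) : PowerSeries ℂ :=
  PowerSeries.mk fun k => if k = 0 then 0 else c k

/-- `μ_{i,j}(c)`, the coefficient of `T^j` in `M(c, T)^i`. For `j < p` it involves no other
coordinates of `c` than `c_1, …, c_{p-1}`. -/
noncomputable def mu (c : ℕ → ℂ) (i j : ℕ) : ℂ :=
  PowerSeries.coeff j (genSeries c ^ i)

/-- The matrix `(μ_{i,j}(c))_{0 ≤ i, j < p}`. -/
noncomputable def muMatrix (p : ℕ) (c : ℕ → ℂ) : Matrix (Fin p) (Fin p) ℂ :=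
  Matrix.of fun i j => mu c i j

theorem X_dvd_genSeries (c : ℕ → ℂ) : PowerSeries.X ∣ genSeries c := by
  rw [PowerSeries.X_dvd_iff]
  simp [genSeries]

theorem mu_eq_zero_of_lt (c : ℕ → ℂ) {i j : ℕ} (h : j < i) : mu c i j = 0 :=
  PowerSeries.X_pow_dvd_iff.1 (pow_dvd_pow_of_dvd (X_dvd_genSeries c) i) j h

theorem mu_one (c : ℕ → ℂ) {j : ℕ} (h : j ≠ 0) : mu c 1 j = c j := by
  simp [mu, genSeries, h]

/-- Substituting power series into each other corresponds to multiplying the matrices. -/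
theorem muMatrix_mul (p : ℕ) (a b : ℕ → ℂ) :
    muMatrix p a * muMatrix p b
      = muMatrix p (fun j => ∑ k ∈ Finset.Ico 1 p, a k * mu b k j) := by
  set z : ℕ → ℂ := fun j => ∑ k ∈ Finset.Ico 1 p, a k * mu b k j with hz
  set A : Polynomial ℂ := PowerSeries.trunc p (genSeries a) with hA
  have hcoeff : ∀ k, A.coeff k = if k ∈ Finset.Ico 1 p then a k else 0 := by
    intro k
    rw [hA, PowerSeries.coeff_trunc]
    simp only [genSeries, PowerSeries.coeff_mk, Finset.mem_Ico]
    by_cases h0 : k = 0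
    · simp [h0]
    · have : 1 ≤ k := Nat.one_le_iff_ne_zero.2 h0
      simp [h0, this]
  have hev : ∀ (Q : Polynomial ℂ) (j : ℕ), j < p →
      PowerSeries.coeff j (Polynomial.aeval (genSeries b) Q)
        = ∑ k ∈ Finset.range p, Q.coeff k * mu b k j := by
    intro Q j hj
    have hN := Polynomial.aeval_eq_sum_range' (p := Q) (n := max p (Q.natDegree + 1))
      (by omega) (genSeries b)
    rw [hN, map_sum]
    symm
    refine (Finset.sum_subset 
      (Finset.range_subset_range.2 (le_max_left p (Q.natDegree + 1))) ?_).trans ?_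
    · intro k _ hk
      rw [Finset.mem_range, not_lt] at hk
      rw [mu_eq_zero_of_lt b (lt_of_lt_of_le hj hk), mul_zero]
    · simp [mu]
  have hzA : genSeries z = Polynomial.aeval (genSeries b) A := by
    have hN := Polynomial.aeval_eq_sum_range' (p := A) (n := max p (A.natDegree + 1))
      (by omega) (genSeries b)
    rw [hN]
    ext j
    rw [map_sum]
    have h1 : ∀ k ∈ Finset.range (max p (A.natDegree + 1)),
        PowerSeries.coeff j (A.coeff k • genSeries b ^ k)
          = if k ∈ Finset.Ico 1 p then a k * mu b k j else 0 := by
      intro k _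
      rw [hcoeff]
      split_ifs <;> simp [mu]
    rw [Finset.sum_congr rfl h1, ← Finset.sum_filter]
    have h2 : (Finset.range (max p (A.natDegree + 1))).filter (· ∈ Finset.Ico 1 p)
        = Finset.Ico 1 p := by
      ext k
      simp only [Finset.mem_filter, Finset.mem_range, Finset.mem_Ico]
      omega
    rw [h2]
    simp only [genSeries, PowerSeries.coeff_mk]
    split_ifs with hj
    · subst hj
      symm
      refine Finset.sum_eq_zero fun k hk => ?_
      rw [mu_eq_zero_of_lt b (by simp at hk; omega), mul_zero]
    · rfl
  ext i j
  simp only [muMatrix, Matrix.mul_apply, Matrix.of_apply]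
  have h3 : mu z i j = ∑ k ∈ Finset.range p, (A ^ (i : ℕ)).coeff k * mu b k j := by
    rw [← hev _ _ j.2, map_pow, ← hzA, mu]
  rw [h3, Finset.sum_range]
  refine Finset.sum_congr rfl fun k _ => ?_
  congr 1
  have h4 := PowerSeries.trunc_trunc_pow (genSeries a) p (i : ℕ)
  have h5 := congrArg (fun q => Polynomial.coeff q (k : ℕ)) h4
  simp only [PowerSeries.coeff_trunc, k.2, if_true] at h5
  rw [mu, ← h5, ← hA, ← Polynomial.coe_pow, Polynomial.coeff_coe]

theorem muMatrix_one (p : ℕ) : muMatrix p (fun k => if k = 1 then 1 else 0) = 1 := by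
  have h : genSeries (fun k => if k = 1 then 1 else 0) = PowerSeries.X := by
    ext k
    simp only [genSeries, PowerSeries.coeff_mk, PowerSeries.coeff_X]
    split_ifs <;> simp_all
  ext i j
  simp only [muMatrix, mu, h, Matrix.of_apply, PowerSeries.coeff_X_pow, Matrix.one_apply,
    Fin.ext_iff, eq_comm]

/-- The matrix `(μ_{i,j}(c))` depends only on `c_1, …, c_{p-1}`. -/
theorem muMatrix_congr (p : ℕ) (c d : ℕ → ℂ) (h : ∀ k, 1 ≤ k → k < p → c k = d k) :
    muMatrix p c = muMatrix p d := by
  have h1 : PowerSeries.trunc p (genSeries c) = PowerSeries.trunc p (genSeries d) := by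
    ext k
    simp only [PowerSeries.coeff_trunc, genSeries, PowerSeries.coeff_mk]
    split_ifs with h1 h2
    · rfl
    · exact h k (Nat.one_le_iff_ne_zero.2 h2) h1
    · rfl
  ext i j
  have h2 := PowerSeries.trunc_trunc_pow (genSeries c) p (i : ℕ)
  rw [h1, PowerSeries.trunc_trunc_pow] at h2
  have h3 := congrArg (fun q => Polynomial.coeff q (j : ℕ)) h2
  simp only [PowerSeries.coeff_trunc, j.2, if_true] at h3
  exact h3.symm

theorem exists_muMatrix_inv (p : ℕ) (c : ℕ → ℂ) (hc : c 1 ≠ 0) :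
    ∃ d : ℕ → ℂ, d 1 ≠ 0 ∧ muMatrix p d * muMatrix p c = 1 := by
  have hdet : IsUnit (muMatrix p c).det := by
    rw [Matrix.det_of_isUpperTriangular]
    · rw [isUnit_iff_ne_zero, Finset.prod_ne_zero_iff]
      intro i _
      obtain ⟨q, hq⟩ := X_dvd_genSeries c
      have h1 : PowerSeries.constantCoeff q = c 1 := by
        have := congrArg (PowerSeries.coeff 1) hq
        rw [show (1 : ℕ) = 0 + 1 from rfl, PowerSeries.coeff_succ_X_mul] at this
        simpa [genSeries] using this.symm
      have h2 : mu c i i = c 1 ^ (i : ℕ) := by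
        rw [mu, hq, mul_pow]
        have := PowerSeries.coeff_X_pow_mul (q ^ (i : ℕ)) (i : ℕ) 0
        rw [zero_add] at this
        rw [this, PowerSeries.coeff_zero_eq_constantCoeff_apply, map_pow, h1]
      simpa [muMatrix, h2] using pow_ne_zero _ hc
    · intro i j hij
      exact mu_eq_zero_of_lt c hij
  rcases Nat.lt_or_ge 1 p with hp | hp
  · set Y := (muMatrix p c)⁻¹ with hY
    have hYX : Y * muMatrix p c = 1 := Matrix.nonsing_inv_mul _ hdet
    let e : Fin p := ⟨1, hp⟩
    let d : ℕ → ℂ := fun k => if h : k < p then Y e ⟨k, h⟩ else 0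
    have hrow : ∀ j : Fin p, ∑ k : Fin p, Y e k * mu c k j = if e = j then 1 else 0 := by
      intro j
      have := congrFun (congrFun hYX e) j
      rwa [Matrix.mul_apply, Matrix.one_apply] at this
    have hsum : ∀ j : Fin p, 1 ≤ (j : ℕ) →
        ∑ k ∈ Finset.Ico 1 p, d k * mu c k j = if e = j then 1 else 0 := by
      intro j hj
      have hd : ∀ k : Fin p, Y e k * mu c k j = d k * mu c k j := by
        intro k
        simp [d]
      rw [← hrow j, Finset.sum_congr rfl fun k _ => hd k,
        ← Finset.sum_range (fun k => d k * mu c k j), Finset.range_eq_Ico,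
        Finset.sum_eq_sum_Ico_succ_bot (show 0 < p by omega)]
      have h0 : mu c 0 j = 0 := by
        simp only [mu, pow_zero, PowerSeries.coeff_one]
        rw [if_neg (by omega)]
      rw [h0, mul_zero, zero_add, zero_add]
    have hprod : muMatrix p d * muMatrix p c = 1 := by
      rw [muMatrix_mul, ← muMatrix_one]
      refine muMatrix_congr _ _ _ fun k h1 h2 => ?_
      rw [hsum ⟨k, h2⟩ h1]
      simp [e, Fin.ext_iff, eq_comm]
    refine ⟨d, fun hd => ?_, hprod⟩
    have h1 := hsum e le_rfl
    rw [if_pos rfl, Finset.sum_eq_single_of_mem 1 (by simp [hp])] at h1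
    · rw [hd, zero_mul] at h1
      exact zero_ne_one h1
    · intro k hk hk1
      have := Finset.mem_Ico.1 hk
      rw [mu_eq_zero_of_lt c (show (e : ℕ) < k by simp only [e]; omega), mul_zero]
  · refine ⟨fun k => if k = 1 then 1 else 0, by simp, ?_⟩
    rw [muMatrix_mul, ← muMatrix_one]
    exact muMatrix_congr _ _ _ fun k h1 h2 => by omega

/-- The group `W_r(p)` of all block matrices `(μ_{i,j}(c) 1_r)_{0 ≤ i, j < p}` with `c_1 ≠ 0`.
Only `c_1, …, c_{p-1}` enter; in particular `W_r(1)` consists of the identity matrix alone. -/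
noncomputable def weylGroup (r p : ℕ) : Subgroup (GL (Fin p × Fin r) ℂ) where
  carrier := {g | ∃ c : ℕ → ℂ, c 1 ≠ 0 ∧
    (g : Matrix (Fin p × Fin r) (Fin p × Fin r) ℂ)
      = muMatrix p c ⊗ₖ (1 : Matrix (Fin r) (Fin r) ℂ)}
  one_mem' := ⟨fun k => if k = 1 then 1 else 0, by simp, by simp [muMatrix_one]⟩
  mul_mem' := by
    rintro x y ⟨a, ha, hx⟩ ⟨b, hb, hy⟩
    rcases Nat.lt_or_ge 1 p with hp | hp
    · refine ⟨fun j => ∑ k ∈ Finset.Ico 1 p, a k * mu b k j, ?_, ?_⟩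
      · beta_reduce
        rw [Finset.sum_eq_single_of_mem 1 (by simp [hp]), mu_one b one_ne_zero]
        · exact mul_ne_zero ha hb
        · intro k hk hk1
          have := Finset.mem_Ico.1 hk
          rw [mu_eq_zero_of_lt b (by omega), mul_zero]
      · rw [Units.val_mul, hx, hy, ← Matrix.mul_kronecker_mul, muMatrix_mul, one_mul]
    · refine ⟨a, ha, ?_⟩
      rw [Units.val_mul, hx, hy, ← Matrix.mul_kronecker_mul, muMatrix_mul, one_mul]
      rw [muMatrix_congr p _ a fun k h1 h2 => by omega]
  inv_mem' := by
    rintro x ⟨c, hc, hx⟩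
    obtain ⟨d, hd, hdc⟩ := exists_muMatrix_inv p c hc
    refine ⟨d, hd, Units.inv_eq_of_mul_eq_one_left ?_⟩
    rw [hx, ← Matrix.mul_kronecker_mul, hdc, one_mul, Matrix.one_kronecker_one]

/-! ### The groups attached to a partition -/

/-- The index set of the rows and columns of `J_r(n)^p`. -/
abbrev PartIndex (r n p : ℕ) : Type := Σ _ : Fin p, Fin n × Fin r

/-- The index set of the rows and columns of the matrices in `H_λ`, where `λ` consists of the parts
`n_i` with multiplicities `p_i`. It has `N = r ∑ p_i n_i` elements, so that `GL (Index r n p) ℂ`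
is `GL(N)`; the blocks are numbered in the lexicographic order. -/
abbrev Index (r : ℕ) {s : ℕ} (n p : Fin s → ℕ) : Type := Σ i : Fin s, PartIndex r (n i) (p i)

/-- `J_r(n)^p`, as block diagonal matrices in `GL(pnr)`. -/
noncomputable def jordanPower (r n p : ℕ) : Subgroup (GL (PartIndex r n p) ℂ) :=
  blockProd fun _ : Fin p => jordanGroup r n

/-- `W_r(n)^p`, as block diagonal matrices in `GL(pnr)`. -/
noncomputable def weylPower (r n p : ℕ) : Subgroup (GL (PartIndex r n p) ℂ) :=
  blockProd fun _ : Fin p => weylGroup r n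

/-- The group of the block permutation matrices `P_σ = (δ_{j, σ(k)} 1_{nr})_{1 ≤ j, k ≤ p}`. -/
def permGroup (r n p : ℕ) : Subgroup (GL (PartIndex r n p) ℂ) :=
  (blockPerm p (Fin n × Fin r)).range

/-- The group generated by `W_r(n)^p` and by the block permutation matrices. -/
noncomputable def weylPermGroup (r n p : ℕ) : Subgroup (GL (PartIndex r n p) ℂ) :=
  weylPower r n p ⊔ permGroup r n p

/-- The group `H_λ = ∏ J_r(n_i)^{p_i}`. -/
noncomputable def hGroup (r : ℕ) {s : ℕ} (n p : Fin s → ℕ) : Subgroup (GL (Index r n p) ℂ) :=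
  blockProd fun i => jordanPower r (n i) (p i)

/-- The subgroup `N` is the (internal) semidirect product `H ⋊ K` of its subgroups `H` and `K`. -/
structure IsSemidirect {G : Type*} [Group G] (N H K : Subgroup G) : Prop where
  left_le : H ≤ N
  right_le : K ≤ N
  conj_mem : ∀ g ∈ N, ∀ h ∈ H, g * h * g⁻¹ ∈ H
  inf_eq_bot : H ⊓ K = ⊥
  exists_mul : ∀ g ∈ N, ∃ h ∈ H, ∃ k ∈ K, g = h * k

end JordanNormalizer

/-! Everything is transferred from groups to algebras. The block Toeplitz matrices form the
commutant of the block shift `X` and make up a copy of Mat_r(ℂ)[X]/(X^n). `J_r(n)` is its unit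
group, and `H_λ` is the unit group of the block diagonal algebra `hAlg`. Every matrix becomes
invertible after adding a suitable scalar, so conjugation by `g` maps `H_λ` into itself only if it
maps `hAlg` into itself. By finite dimension it is then onto, which makes the one-sided condition
sufficient, and it preserves the commutant of `hAlg` as well.

That commutant is a product of local rings ℂ[X]/(X^{n_i}), one for each diagonal block, so its
primitive idempotents are the block projections and `g` permutes them (`exists_perm_blockIdem`). The
trace of a projection is `n_i r`. As the `n_i` are distinct, only blocks of equal size are
exchanged. Dividing `g` by the corresponding block permutation matrix leaves a block diagonal
matrix.

For one block (`exists_jordanGroup_mul_weylGroup`), `Y = g⁻¹ X g` lies in the commutant, hence is a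
scalar power series in `X`. It is nilpotent of exact order `n`, so its constant term vanishes and,
for `n > 1`, its linear coefficient does not. The matrix `w` in `W_r(n)` of the substitution `T ↦
c_1 T + c_2 T² + ⋯` satisfies `X w = w Y` (`shift_mul_muMatrix`). Since also `X g = g Y`, the
quotient `g w⁻¹` commutes with `X` and so lies in `J_r(n)`.

The intersections are trivial because a Toeplitz matrix is determined by its top block row, which is
(1, 0, …, 0) for elements of `W_r(n)`, and because a block permutation matrix is block diagonal only
for the identity permutation. -/

namespace JordanNormalizer

open scoped Kronecker

/-! ### A single Jordan block -/

section SingleBlock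

variable {r n : ℕ}

/-- The block shift matrix, the Toeplitz matrix of the power series `X`. -/
noncomputable def shift (r n : ℕ) : Matrix (Fin n × Fin r) (Fin n × Fin r) ℂ :=
  toeplitz r n fun k => PowerSeries.coeff k PowerSeries.X

/-- The algebra of all block Toeplitz matrices, as the commutant of the shift. -/
noncomputable def toeplitzAlg (r n : ℕ) : Subalgebra ℂ (Matrix (Fin n × Fin r) (Fin n × Fin r) ℂ) :=
  Subalgebra.centralizer ℂ {shift r n}

/-- The Toeplitz matrix of a power series with matrix coefficients, as a ring homomorphism. -/
noncomputable def toeplitzHom (r n : ℕ) :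
    PowerSeries (Matrix (Fin r) (Fin r) ℂ) →+* Matrix (Fin n × Fin r) (Fin n × Fin r) ℂ where
  toFun f := toeplitz r n fun k => PowerSeries.coeff k f
  map_one' := toeplitz_one r n
  map_mul' f g := (toeplitz_mul r n f g).symm
  map_zero' := by ext; simp [toeplitz]
  map_add' f g := by
    ext
    simp only [toeplitz, map_add, Matrix.of_apply, Matrix.add_apply]
    split_ifs <;> simp

theorem toeplitzHom_apply (f : PowerSeries (Matrix (Fin r) (Fin r) ℂ)) (x y : Fin n × Fin r) :
    toeplitzHom r n f x y
      = if x.1 ≤ y.1 then PowerSeries.coeff (y.1 - x.1 : ℕ) f x.2 y.2 else 0 := rfl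

theorem toeplitzHom_mk (h : ℕ → Matrix (Fin r) (Fin r) ℂ) :
    toeplitzHom r n (PowerSeries.mk h) = toeplitz r n h := by
  ext
  simp [toeplitzHom_apply, toeplitz]

theorem toeplitzHom_X : toeplitzHom r n PowerSeries.X = shift r n := rfl

theorem toeplitzHom_eq_zero_of_dvd {f : PowerSeries (Matrix (Fin r) (Fin r) ℂ)}
    (h : PowerSeries.X ^ n ∣ f) : toeplitzHom r n f = 0 := by
  ext x y
  rw [toeplitzHom_apply, PowerSeries.X_pow_dvd_iff.1 h _ (by have := y.1.2; omega)]
  simp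

/-! ### The commutant of the shift -/

theorem shift_apply (x y : Fin n × Fin r) :
    shift r n x y = if (y.1 : ℕ) = x.1 + 1 ∧ x.2 = y.2 then 1 else 0 := by
  rw [← toeplitzHom_X, toeplitzHom_apply, PowerSeries.coeff_X]
  by_cases h : (y.1 : ℕ) = x.1 + 1
  · rw [if_pos (by rw [Fin.le_def]; omega), if_pos (by omega), Matrix.one_apply]
    simp [h]
  · have h' : ¬ ((y.1 : ℕ) = x.1 + 1 ∧ x.2 = y.2) := fun h' => h h'.1
    rw [if_neg h']
    split_ifs with h1 h2
    · rw [Fin.le_def] at h1; omega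
    · rfl
    · rfl

theorem shift_mul_apply (M : Matrix (Fin n × Fin r) (Fin n × Fin r) ℂ) (x y : Fin n × Fin r) :
    (shift r n * M) x y = if h : (x.1 : ℕ) + 1 < n then M (⟨x.1 + 1, h⟩, x.2) y else 0 := by
  rw [Matrix.mul_apply]
  split_ifs with h
  · rw [Finset.sum_eq_single (⟨x.1 + 1, h⟩, x.2)]
    · simp [shift_apply]
    · rintro ⟨k, c⟩ _ hne
      rw [shift_apply, if_neg, zero_mul]
      rintro ⟨h1, h2⟩
      exact hne (Prod.ext (Fin.ext h1) h2.symm)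
    · simp
  · refine Finset.sum_eq_zero fun k _ => ?_
    rw [shift_apply, if_neg, zero_mul]
    rintro ⟨h1, -⟩
    have := k.1.2
    omega

theorem mul_shift_apply_zero (M : Matrix (Fin n × Fin r) (Fin n × Fin r) ℂ) (x y : Fin n × Fin r)
    (h : (y.1 : ℕ) = 0) : (M * shift r n) x y = 0 := by
  rw [Matrix.mul_apply]
  refine Finset.sum_eq_zero fun k _ => ?_
  rw [shift_apply, if_neg, mul_zero]
  rintro ⟨h1, -⟩
  omega

theorem mul_shift_apply_succ (M : Matrix (Fin n × Fin r) (Fin n × Fin r) ℂ) (x : Fin n × Fin r)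
    (j : ℕ) (h : j + 1 < n) (b : Fin r) :
    (M * shift r n) x (⟨j + 1, h⟩, b) = M x (⟨j, by omega⟩, b) := by
  rw [Matrix.mul_apply, Finset.sum_eq_single (⟨j, by omega⟩, b)]
  · simp [shift_apply]
  · rintro ⟨k, c⟩ _ hne
    rw [shift_apply, if_neg, mul_zero]
    rintro ⟨h1, h2⟩
    exact hne (Prod.ext (Fin.ext (by simp only at h1 ⊢; omega)) h2)
  · simp

/-- Comparing entries of `X M` and `M X` gives M_{i+1,j+1} = M_{i,j} and M_{i+1,0} = 0, so induction
on the row expresses every block through the top block row. -/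
theorem exists_eq_toeplitz_of_commute (M : Matrix (Fin n × Fin r) (Fin n × Fin r) ℂ)
    (hM : shift r n * M = M * shift r n) : ∃ h, M = toeplitz r n h := by
  rcases Nat.eq_zero_or_pos n with rfl | hn
  · exact ⟨0, by ext ⟨i, _⟩; exact i.elim0⟩
  refine ⟨fun k => Matrix.of fun a b => if h : k < n then M (⟨0, hn⟩, a) (⟨k, h⟩, b) else 0, ?_⟩
  have key : ∀ (i : ℕ) (hi : i < n) (a : Fin r) (j : ℕ) (hj : j < n) (b : Fin r),
      M (⟨i, hi⟩, a) (⟨j, hj⟩, b)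
        = if i ≤ j then M (⟨0, hn⟩, a) (⟨j - i, by omega⟩, b) else 0 := by
    intro i
    induction i with
    | zero => intro hi a j hj b; simp
    | succ i ih =>
      intro hi a j hj b
      have h1 : M (⟨i + 1, hi⟩, a) (⟨j, hj⟩, b)
          = (shift r n * M) (⟨i, by omega⟩, a) (⟨j, hj⟩, b) := by
        rw [shift_mul_apply, dif_pos hi]
      rw [h1, hM]
      rcases j with _ | j
      · rw [mul_shift_apply_zero _ _ _ rfl, if_neg (by omega)]
      · rw [mul_shift_apply_succ, ih]
        simp only [Nat.add_le_add_iff_right, Nat.add_sub_add_right]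
  ext ⟨i, a⟩ ⟨j, b⟩
  rw [key i i.2 a j j.2 b]
  simp only [toeplitz, Matrix.of_apply, Fin.le_def]
  split_ifs with h1 h2
  · rfl
  · omega
  · rfl

theorem mem_toeplitzAlg {M : Matrix (Fin n × Fin r) (Fin n × Fin r) ℂ} :
    M ∈ toeplitzAlg r n ↔ ∃ f, M = toeplitzHom r n f := by
  rw [toeplitzAlg, Subalgebra.mem_centralizer_iff]
  constructor
  · intro h
    obtain ⟨f, rfl⟩ := exists_eq_toeplitz_of_commute M (h _ rfl)
    exact ⟨PowerSeries.mk f, (toeplitzHom_mk f).symm⟩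
  · rintro ⟨f, rfl⟩ _ rfl
    rw [← toeplitzHom_X, ← map_mul, ← map_mul, (PowerSeries.commute_X f).eq]

theorem shift_mem_toeplitzAlg : shift r n ∈ toeplitzAlg r n :=
  mem_toeplitzAlg.2 ⟨PowerSeries.X, rfl⟩

theorem isUnit_coeff_zero_of_mul_eq_one (hn : 0 < n)
    {f g : PowerSeries (Matrix (Fin r) (Fin r) ℂ)}
    (h : toeplitzHom r n f * toeplitzHom r n g = 1) : IsUnit (PowerSeries.coeff 0 f) := by
  have h1 : PowerSeries.coeff 0 f * PowerSeries.coeff 0 g = 1 := by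
    rw [← map_mul] at h
    ext a b
    have h2 := congrFun (congrFun h (⟨0, hn⟩, a)) (⟨0, hn⟩, b)
    rw [toeplitzHom_apply, if_pos le_rfl] at h2
    simp only [Nat.sub_self, PowerSeries.coeff_zero_eq_constantCoeff, map_mul] at h2 ⊢
    rw [h2]
    simp [Matrix.one_apply]
  exact IsUnit.of_mul_eq_one _ h1

/-- The invertibility of `h_0` is automatic: the inverse of `g` also commutes with the shift, hence
is Toeplitz, and the top left blocks of the two are inverse to each other. -/
theorem mem_jordanGroup_iff (g : GL (Fin n × Fin r) ℂ) :
    g ∈ jordanGroup r n ↔ (g : Matrix (Fin n × Fin r) (Fin n × Fin r) ℂ) ∈ toeplitzAlg r n := by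
  constructor
  · rintro ⟨h, -, hg⟩
    exact mem_toeplitzAlg.2 ⟨PowerSeries.mk h, by rw [hg, toeplitzHom_mk]⟩
  · intro hg
    rcases Nat.eq_zero_or_pos n with rfl | hn
    · exact ⟨1, by simp, by ext ⟨i, _⟩; exact i.elim0⟩
    have hg' : ((g⁻¹ : GL (Fin n × Fin r) ℂ) : Matrix _ _ ℂ) ∈ toeplitzAlg r n := by
      rw [toeplitzAlg, Subalgebra.mem_centralizer_iff] at hg ⊢
      rintro _ rfl
      exact (Commute.units_inv_right (hg _ rfl)).eq
    obtain ⟨f, hf⟩ := mem_toeplitzAlg.1 hg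
    obtain ⟨f', hf'⟩ := mem_toeplitzAlg.1 hg'
    refine ⟨fun k => PowerSeries.coeff k f, isUnit_coeff_zero_of_mul_eq_one (g := f') hn ?_, hf⟩
    rw [← hf, ← hf', Units.mul_inv]

/-! ### Scalar power series and the commutant of the Toeplitz algebra -/

/-- The Toeplitz matrix of a power series with scalar coefficients. -/
noncomputable def scalarToeplitz (r n : ℕ) :
    PowerSeries ℂ →+* Matrix (Fin n × Fin r) (Fin n × Fin r) ℂ :=
  (toeplitzHom r n).comp (PowerSeries.map (algebraMap ℂ (Matrix (Fin r) (Fin r) ℂ)))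

theorem scalarToeplitz_apply (f : PowerSeries ℂ) (x y : Fin n × Fin r) :
    scalarToeplitz r n f x y
      = if x.1 ≤ y.1 ∧ x.2 = y.2 then PowerSeries.coeff (y.1 - x.1 : ℕ) f else 0 := by
  rw [scalarToeplitz, RingHom.comp_apply, toeplitzHom_apply, PowerSeries.coeff_map,
    Matrix.algebraMap_matrix_apply]
  by_cases h : x.1 ≤ y.1 <;> simp [h]

theorem scalarToeplitz_X : scalarToeplitz r n PowerSeries.X = shift r n := by
  rw [scalarToeplitz, RingHom.comp_apply, PowerSeries.map_X, toeplitzHom_X]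

theorem scalarToeplitz_eq_zero_of_dvd {f : PowerSeries ℂ} (h : PowerSeries.X ^ n ∣ f) :
    scalarToeplitz r n f = 0 := by
  refine toeplitzHom_eq_zero_of_dvd ?_
  have := map_dvd (PowerSeries.map (algebraMap ℂ (Matrix (Fin r) (Fin r) ℂ))) h
  rwa [map_pow, PowerSeries.map_X] at this

theorem scalarToeplitz_mem_centralizer (f : PowerSeries ℂ) :
    scalarToeplitz r n f ∈ Subalgebra.centralizer ℂ (toeplitzAlg r n : Set (Matrix _ _ ℂ)) := by
  rw [Subalgebra.mem_centralizer_iff]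
  intro M hM
  obtain ⟨g, rfl⟩ := mem_toeplitzAlg.1 hM
  rw [scalarToeplitz, RingHom.comp_apply, ← map_mul, ← map_mul]
  congr 1
  ext1 k
  rw [PowerSeries.coeff_mul, PowerSeries.coeff_mul, ← Finset.Nat.sum_antidiagonal_swap]
  refine Finset.sum_congr rfl fun x _ => ?_
  simp only [PowerSeries.coeff_map, Prod.fst_swap, Prod.snd_swap]
  exact (Algebra.commutes _ _).symm

/-- Commuting with the shift makes `M` Toeplitz. Commuting with the constant series given by matrix
units then makes each coefficient of index below `n` a scalar matrix; the other coefficients do not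
enter. -/
theorem exists_eq_scalarToeplitz {M : Matrix (Fin n × Fin r) (Fin n × Fin r) ℂ}
    (hM : M ∈ Subalgebra.centralizer ℂ (toeplitzAlg r n : Set (Matrix _ _ ℂ))) :
    ∃ f, M = scalarToeplitz r n f := by
  rw [Subalgebra.mem_centralizer_iff] at hM
  obtain ⟨f, rfl⟩ := exists_eq_toeplitz_of_commute M (hM _ shift_mem_toeplitzAlg)
  have key : ∀ k < n, ∃ c : ℂ, f k = algebraMap ℂ _ c := by
    intro k hk
    have h1 : f k ∈ Set.range (Matrix.scalar (Fin r)) := by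
      refine Matrix.mem_range_scalar_of_commute_single fun i j _ => ?_
      have h2 := hM _ (mem_toeplitzAlg.2
        ⟨PowerSeries.C (Matrix.single i j (1 : ℂ)), rfl⟩)
      rw [← toeplitzHom_mk, ← map_mul, ← map_mul] at h2
      ext a b
      have h3 := congrFun (congrFun h2 (⟨0, by omega⟩, a)) (⟨k, hk⟩, b)
      rw [toeplitzHom_apply, toeplitzHom_apply, if_pos (by simp [Fin.le_def]),
        if_pos (by simp [Fin.le_def])] at h3
      simpa [PowerSeries.coeff_C_mul, PowerSeries.coeff_mul_C] using h3
    obtain ⟨c, hc⟩ := h1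
    exact ⟨c, hc ▸ rfl⟩
  choose! c hc using key
  refine ⟨PowerSeries.mk c, ?_⟩
  rw [scalarToeplitz, RingHom.comp_apply]
  ext x y
  rw [toeplitzHom_apply, toeplitz, Matrix.of_apply]
  simp only [PowerSeries.coeff_map, PowerSeries.coeff_mk]
  rw [hc _ (by have := y.1.2; omega)]

theorem constantCoeff_eq_zero_of_pow_eq_zero (hr : 0 < r) (hn : 0 < n) {f : PowerSeries ℂ} {k : ℕ}
    (h : scalarToeplitz r n f ^ k = 0) : PowerSeries.constantCoeff f = 0 := by
  rw [← map_pow] at h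
  have h1 := congrFun (congrFun h (⟨0, hn⟩, ⟨0, hr⟩)) (⟨0, hn⟩, ⟨0, hr⟩)
  rw [scalarToeplitz_apply, if_pos ⟨le_rfl, rfl⟩] at h1
  simp only [Nat.sub_self, PowerSeries.coeff_zero_eq_constantCoeff, map_pow] at h1
  exact pow_eq_zero_iff (by rintro rfl; simp at h1) |>.1 h1

theorem shift_pow_self : shift r n ^ n = 0 := by
  rw [← scalarToeplitz_X, ← map_pow]
  exact scalarToeplitz_eq_zero_of_dvd dvd_rfl

theorem shift_pow_ne_zero (hr : 0 < r) {k : ℕ} (hk : k < n) : shift r n ^ k ≠ 0 := by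
  intro h
  rw [← scalarToeplitz_X, ← map_pow] at h
  have h1 := congrFun (congrFun h (⟨0, by omega⟩, ⟨0, hr⟩)) (⟨k, hk⟩, ⟨0, hr⟩)
  rw [scalarToeplitz_apply, if_pos ⟨by simp [Fin.le_def], rfl⟩] at h1
  simp [PowerSeries.coeff_X_pow] at h1

/-- An idempotent scalar Toeplitz matrix is `0` or `1`. -/
theorem scalarToeplitz_eq_zero_or_one_of_idempotent (hr : 0 < r) (hn : 0 < n) {f : PowerSeries ℂ}
    (h : scalarToeplitz r n f * scalarToeplitz r n f = scalarToeplitz r n f) :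
    scalarToeplitz r n f = 0 ∨ scalarToeplitz r n f = 1 := by
  -- An idempotent equals its own `n`-th power, which vanishes once `X` divides the series. If the
  -- constant term is 1, this is applied to `1 - f`.
  have key : ∀ g : PowerSeries ℂ, IsIdempotentElem (scalarToeplitz r n g) →
      PowerSeries.constantCoeff g = 0 → scalarToeplitz r n g = 0 := by
    intro g hg h0
    rw [← hg.pow_eq hn.ne', ← map_pow]
    exact scalarToeplitz_eq_zero_of_dvd (pow_dvd_pow_of_dvd (PowerSeries.X_dvd_iff.2 h0) n)
  have h1 := congrFun (congrFun h (⟨0, hn⟩, ⟨0, hr⟩)) (⟨0, hn⟩, ⟨0, hr⟩)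
  rw [← map_mul, scalarToeplitz_apply, scalarToeplitz_apply, if_pos ⟨le_rfl, rfl⟩,
    if_pos ⟨le_rfl, rfl⟩] at h1
  simp only [Nat.sub_self, PowerSeries.coeff_zero_eq_constantCoeff, map_mul] at h1
  rcases IsIdempotentElem.iff_eq_zero_or_one.1 h1 with h0 | h0
  · exact Or.inl (key f h h0)
  · right
    have := key (1 - f) (by rw [map_sub, map_one]; exact IsIdempotentElem.one_sub h) (by simp [h0])
    rw [map_sub, map_one, sub_eq_zero] at this
    exact this.symm

/-! ### Substitutions and the normalizer of one Toeplitz algebra -/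

/-- The substitution matrix intertwines the shift with multiplication by the substituted series. -/
theorem shift_mul_muMatrix (c : ℕ → ℂ) :
    shift r n * (muMatrix n c ⊗ₖ (1 : Matrix (Fin r) (Fin r) ℂ))
      = (muMatrix n c ⊗ₖ (1 : Matrix (Fin r) (Fin r) ℂ)) * scalarToeplitz r n (genSeries c) := by
  ext ⟨i, a⟩ ⟨j, b⟩
  have hL : (shift r n * (muMatrix n c ⊗ₖ (1 : Matrix (Fin r) (Fin r) ℂ))) (i, a) (j, b)
      = mu c (i + 1) j * (1 : Matrix (Fin r) (Fin r) ℂ) a b := by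
    rw [shift_mul_apply]
    split_ifs with h
    · simp [Matrix.kroneckerMap_apply, muMatrix]
    -- In the last block row the shift produces 0, in agreement with μ_{n,j} = 0 for j < n.
    · rw [mu_eq_zero_of_lt c (by simp only at h; have := j.2; omega), zero_mul]
  rw [hL, Matrix.mul_apply, Fintype.sum_prod_type]
  simp only [Matrix.kroneckerMap_apply, scalarToeplitz_apply, muMatrix, Matrix.of_apply]
  have hin : ∀ k : Fin n, (∑ d : Fin r, mu c i k * (1 : Matrix (Fin r) (Fin r) ℂ) a d *
      (if k ≤ j ∧ d = b then PowerSeries.coeff ((j : ℕ) - k) (genSeries c) else 0))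
      = (if (k : ℕ) ≤ j then mu c i k * PowerSeries.coeff ((j : ℕ) - k) (genSeries c) else 0)
        * (1 : Matrix (Fin r) (Fin r) ℂ) a b := by
    intro k
    rw [Finset.sum_eq_single b]
    · by_cases h : k ≤ j
      · have h' : (k : ℕ) ≤ j := h
        simp only [h, h', true_and, if_true]; ring
      · have h' : ¬ (k : ℕ) ≤ j := h
        simp [h, h']
    · intro d _ hd
      simp [hd]
    · simp
  rw [Finset.sum_congr rfl fun k _ => hin k, ← Finset.sum_mul]
  congr 1
  rw [← Finset.sum_range (fun k => if k ≤ (j : ℕ) then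
    mu c i k * PowerSeries.coeff ((j : ℕ) - k) (genSeries c) else 0), mu, pow_succ,
    PowerSeries.coeff_mul, Finset.Nat.sum_antidiagonal_eq_sum_range_succ_mk]
  refine (Finset.sum_subset_zero_on_sdiff (Finset.range_subset_range.2 j.2) ?_ ?_)
  · intro k hk
    rw [if_neg]
    simp only [Finset.mem_sdiff, Finset.mem_range] at hk
    omega
  · intro k hk
    rw [Finset.mem_range] at hk
    rw [if_pos (by omega)]
    rfl


/-- With `M` the scalar Toeplitz matrix of `genSeries c`, `X w = w M` and `M` commutes with `a`;
hence `X (w a w⁻¹) = w M a w⁻¹ = w a M w⁻¹ = (w a w⁻¹) X`. -/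
theorem weylGroup_conj_mem {w : GL (Fin n × Fin r) ℂ} (hw : w ∈ weylGroup r n)
    {a : Matrix (Fin n × Fin r) (Fin n × Fin r) ℂ} (ha : a ∈ toeplitzAlg r n) :
    (w : Matrix (Fin n × Fin r) (Fin n × Fin r) ℂ) * a * (w⁻¹ : GL (Fin n × Fin r) ℂ)
      ∈ toeplitzAlg r n := by
  obtain ⟨c, -, hc⟩ := hw
  have h1 := shift_mul_muMatrix (r := r) (n := n) c
  rw [← hc] at h1
  have h2 := (Subalgebra.mem_centralizer_iff ℂ).1
    (scalarToeplitz_mem_centralizer (r := r) (n := n) (genSeries c)) a ha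
  have h3 : ((w⁻¹ : GL (Fin n × Fin r) ℂ) : Matrix _ _ ℂ) * shift r n
      = scalarToeplitz r n (genSeries c) * 
          ((w⁻¹ : GL (Fin n × Fin r) ℂ) : Matrix (Fin n × Fin r) (Fin n × Fin r) ℂ) := by
    rw [Units.inv_mul_eq_iff_eq_mul, ← mul_assoc, Units.eq_mul_inv_iff_mul_eq, h1]
  rw [toeplitzAlg, Subalgebra.mem_centralizer_iff]
  rintro _ rfl
  simp only [mul_assoc]
  rw [h3, ← mul_assoc a, h2, ← mul_assoc (shift r n), h1]
  simp only [mul_assoc]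

theorem jordanGroup_inf_weylGroup : jordanGroup r n ⊓ weylGroup r n = ⊥ := by
  rw [eq_bot_iff]
  rintro g ⟨⟨h, -, hg⟩, ⟨c, -, hc⟩⟩
  rw [Subgroup.mem_bot]
  refine Units.ext ?_
  rw [Units.val_one, ← toeplitz_one, hg]
  ext ⟨i, a⟩ ⟨j, b⟩
  simp only [toeplitz, Matrix.of_apply]
  split_ifs with hij
  · have hij' : (i : ℕ) ≤ j := hij
    have h0 : 0 < n := by have := i.2; omega
    -- The Toeplitz coefficient of index `j - i` is read off in the top block row, where the other
    -- description of `g` gives the coefficients of the 0-th power, that is, of 1.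
    have h1 := congrFun (congrFun (hg.symm.trans hc) (⟨0, h0⟩, a)) (⟨(j : ℕ) - i, by omega⟩, b)
    simp only [toeplitz, Matrix.of_apply, Matrix.kroneckerMap_apply, muMatrix, mu, pow_zero,
      Fin.le_def, Nat.zero_le, if_true, Nat.sub_zero, PowerSeries.coeff_one] at h1
    rw [h1, PowerSeries.coeff_one]
    split_ifs <;> simp
  · rfl

/-- A matrix normalizing the algebra of block Toeplitz matrices is the product of an element of the
Jordan group and an element of `W_r(n)`. -/
theorem exists_jordanGroup_mul_weylGroup (hr : 0 < r) (hn : 0 < n) (g : GL (Fin n × Fin r) ℂ)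
    (hg : ∀ a ∈ toeplitzAlg r n, (g : Matrix (Fin n × Fin r) (Fin n × Fin r) ℂ) * a *
      (g⁻¹ : GL (Fin n × Fin r) ℂ) ∈ toeplitzAlg r n) :
    ∃ h ∈ jordanGroup r n, ∃ w ∈ weylGroup r n, g = h * w := by
  set Y : Matrix (Fin n × Fin r) (Fin n × Fin r) ℂ :=
    (g⁻¹ : GL (Fin n × Fin r) ℂ) * shift r n * g with hY
  have hX : shift r n ∈ Subalgebra.centralizer ℂ (toeplitzAlg r n : Set (Matrix _ _ ℂ)) := by
    rw [← scalarToeplitz_X]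
    exact scalarToeplitz_mem_centralizer _
  have hYpow : ∀ k, Y ^ k = (g⁻¹ : GL (Fin n × Fin r) ℂ) * shift r n ^ k * g := fun k => by
    rw [hY, Units.conj_pow']
  have hYc : Y ∈ Subalgebra.centralizer ℂ (toeplitzAlg r n : Set (Matrix _ _ ℂ)) := by
    rw [Subalgebra.mem_centralizer_iff] at hX ⊢
    intro a ha
    have h1 := hX _ (hg a ha)
    calc a * Y = (g⁻¹ : GL (Fin n × Fin r) ℂ) *
          ((g : Matrix (Fin n × Fin r) (Fin n × Fin r) ℂ) * a *
            (g⁻¹ : GL (Fin n × Fin r) ℂ) * shift r n) * g := by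
          simp only [hY, mul_assoc, Units.inv_mul_cancel_left]
      _ = Y * a := by
          rw [h1]
          simp only [hY, mul_assoc, Units.inv_mul, mul_one]
  obtain ⟨f, hf⟩ := exists_eq_scalarToeplitz hYc
  have hf0 : PowerSeries.constantCoeff f = 0 := by
    refine constantCoeff_eq_zero_of_pow_eq_zero hr hn (k := n) ?_
    rw [← hf, hYpow, shift_pow_self, mul_zero, zero_mul]
  have hf1 : 1 < n → PowerSeries.coeff 1 f ≠ 0 := by
    intro hn1 h1
    have h2 : PowerSeries.X ^ 2 ∣ f := by
      rw [PowerSeries.X_pow_dvd_iff]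
      intro m hm
      interval_cases m
      · simpa using hf0
      · exact h1
    -- If `X²` divided `f`, then `X^(2(n-1))` would divide `f^(n-1)`, and 2(n-1) ≥ n because n > 1.
    -- This contradicts `X^(n-1) ≠ 0`.
    have h3 : Y ^ (n - 1) = 0 := by
      rw [hf, ← map_pow]
      refine scalarToeplitz_eq_zero_of_dvd (dvd_trans (pow_dvd_pow _ ?_)
        ((pow_mul (PowerSeries.X : PowerSeries ℂ) 2 (n - 1)).symm ▸ pow_dvd_pow_of_dvd h2 (n - 1)))
      omega
    rw [hYpow, Units.mul_left_eq_zero, Units.mul_right_eq_zero] at h3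
    exact shift_pow_ne_zero hr (by omega) h3
  -- For `n = 1` the linear coefficient of `f` is invisible and may vanish, so the value 1 is used
  -- to secure `c 1 ≠ 0`.
  set c : ℕ → ℂ := fun k => if n = 1 then 1 else PowerSeries.coeff k f with hc
  have hc1 : c 1 ≠ 0 := by
    simp only [hc]
    split_ifs with h
    · exact one_ne_zero
    · exact hf1 (by omega)
  have hYgen : Y = scalarToeplitz r n (genSeries c) := by
    rw [hf]
    ext x y
    rw [scalarToeplitz_apply, scalarToeplitz_apply]
    congr 1
    simp only [genSeries, PowerSeries.coeff_mk, hc]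
    split_ifs with h1 h2
    · rw [h1]; simpa using hf0
    · have := y.1.2; omega
    · rfl
  obtain ⟨d, -, hdc⟩ := exists_muMatrix_inv n c hc1
  have hcd := mul_eq_one_comm.1 hdc
  let w : GL (Fin n × Fin r) ℂ :=
    ⟨muMatrix n c ⊗ₖ 1, muMatrix n d ⊗ₖ 1,
      by rw [← Matrix.mul_kronecker_mul, hcd, one_mul, Matrix.one_kronecker_one],
      by rw [← Matrix.mul_kronecker_mul, hdc, one_mul, Matrix.one_kronecker_one]⟩
  have hw : w ∈ weylGroup r n := ⟨c, hc1, rfl⟩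
  refine ⟨g * w⁻¹, ?_, w, hw, by group⟩
  rw [mem_jordanGroup_iff, toeplitzAlg, Subalgebra.mem_centralizer_iff]
  rintro _ rfl
  have h1 : shift r n * (w : Matrix (Fin n × Fin r) (Fin n × Fin r) ℂ) = w * Y := by
    rw [hYgen]
    exact shift_mul_muMatrix c
  have h2 : shift r n * (g : Matrix (Fin n × Fin r) (Fin n × Fin r) ℂ) = g * Y := by
    simp only [hY, mul_assoc, Units.mul_inv_cancel_left]
  rw [Units.val_mul, ← mul_assoc, h2, Units.mul_inv_eq_iff_eq_mul, mul_assoc, mul_assoc, h1,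
    Units.inv_mul_cancel_left]

end SingleBlock

/-! ### Normalizers of unit groups of matrix algebras -/

section Units

variable {m : Type*} [Fintype m] [DecidableEq m]

/-- The spectrum of `-a` is finite and ℂ is infinite. This is what lets the unit group of a matrix
algebra control the whole algebra. -/
theorem exists_isUnit_add_algebraMap (a : Matrix m m ℂ) :
    ∃ t : ℂ, IsUnit (a + algebraMap ℂ (Matrix m m ℂ) t) := by
  obtain ⟨t, ht⟩ := Set.Infinite.nonempty (Set.Finite.infinite_compl
    (Matrix.finite_spectrum (-a) : (spectrum ℂ (-a)).Finite))
  refine ⟨t, ?_⟩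
  rw [Set.mem_compl_iff, spectrum.notMem_iff, sub_neg_eq_add, add_comm] at ht
  exact ht

/-- If conjugation by `g` maps the units of the algebra `S` into `S`, then it preserves `S`. -/
theorem conj_mem_of_units {S : Subalgebra ℂ (Matrix m m ℂ)} {g : GL m ℂ}
    (h : ∀ u : GL m ℂ, (u : Matrix m m ℂ) ∈ S →
      (g : Matrix m m ℂ) * u * (g⁻¹ : GL m ℂ) ∈ S)
    {a : Matrix m m ℂ} (ha : a ∈ S) : (g : Matrix m m ℂ) * a * (g⁻¹ : GL m ℂ) ∈ S := by
  obtain ⟨t, u, hu⟩ := exists_isUnit_add_algebraMap a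
  have h1 := h u (hu ▸ S.add_mem ha (S.algebraMap_mem t))
  have h2 : (g : Matrix m m ℂ) * a * (g⁻¹ : GL m ℂ)
      = (g : Matrix m m ℂ) * u * (g⁻¹ : GL m ℂ) - algebraMap ℂ _ t := by
    rw [hu, mul_add, add_mul, ← Algebra.commutes, mul_assoc (algebraMap ℂ _ t), Units.mul_inv,
      mul_one, add_sub_cancel_right]
  rw [h2]
  exact S.sub_mem h1 (S.algebraMap_mem t)

/-- If conjugation by `g` preserves `S`, then so does conjugation by `g⁻¹`. -/
theorem inv_conj_mem {S : Subalgebra ℂ (Matrix m m ℂ)} {g : GL m ℂ}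
    (h : ∀ a ∈ S, (g : Matrix m m ℂ) * a * (g⁻¹ : GL m ℂ) ∈ S)
    {a : Matrix m m ℂ} (ha : a ∈ S) : ((g⁻¹ : GL m ℂ) : Matrix m m ℂ) * a * g ∈ S := by
  let φ : S →ₗ[ℂ] S :=
    { toFun := fun x => ⟨g * x * (g⁻¹ : GL m ℂ), h x x.2⟩
      map_add' := fun x y => Subtype.ext (by simp [mul_add, add_mul])
      map_smul' := fun t x => Subtype.ext (by simp) }
  have hinj : Function.Injective φ := by
    intro x y hxy
    have := congrArg Subtype.val hxy
    exact Subtype.ext (g.isUnit.mul_left_cancel ((g⁻¹).isUnit.mul_right_cancel this))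
  -- Finite dimension of `S`: the injective endomorphism given by conjugation is onto.
  obtain ⟨b, hb⟩ := LinearMap.injective_iff_surjective.1 hinj ⟨a, ha⟩
  have hb' : (g : Matrix m m ℂ) * b * (g⁻¹ : GL m ℂ) = a := congrArg Subtype.val hb
  rw [← hb', mul_assoc, Units.inv_mul_cancel_right, Units.inv_mul_cancel_left]
  exact b.2

/-- If conjugation by `g` preserves `S`, then it preserves the commutant of `S`. -/
theorem conj_mem_centralizer {S : Subalgebra ℂ (Matrix m m ℂ)} {g : GL m ℂ}
    (h : ∀ a ∈ S, (g : Matrix m m ℂ) * a * (g⁻¹ : GL m ℂ) ∈ S)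
    {z : Matrix m m ℂ} (hz : z ∈ Subalgebra.centralizer ℂ (S : Set (Matrix m m ℂ))) :
    (g : Matrix m m ℂ) * z * (g⁻¹ : GL m ℂ)
      ∈ Subalgebra.centralizer ℂ (S : Set (Matrix m m ℂ)) := by
  rw [Subalgebra.mem_centralizer_iff] at hz ⊢
  intro a ha
  have h1 := hz _ (inv_conj_mem h ha)
  calc a * ((g : Matrix m m ℂ) * z * (g⁻¹ : GL m ℂ))
      = g * (((g⁻¹ : GL m ℂ) : Matrix m m ℂ) * a * g * z) * (g⁻¹ : GL m ℂ) := by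
        simp only [mul_assoc, Units.mul_inv_cancel_left]
    _ = _ := by
        rw [h1]
        simp only [mul_assoc, Units.mul_inv, mul_one]

end Units


/-! ### Algebras of block diagonal matrices -/

theorem single_mem {ι : Type*} [DecidableEq ι] {m : ι → Type*} [∀ i, Fintype (m i)]
    [∀ i, DecidableEq (m i)] {S : ∀ i, Subalgebra ℂ (Matrix (m i) (m i) ℂ)} {i : ι}
    {a : Matrix (m i) (m i) ℂ} (ha : a ∈ S i) (j : ι) :
    (Pi.single i a : ∀ i, Matrix (m i) (m i) ℂ) j ∈ S j := by
  by_cases h : j = i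
  · subst h
    rwa [Pi.single_eq_same]
  · rw [Pi.single_eq_of_ne h]
    exact zero_mem _

section BlockAlg

variable {ι : Type*} [Fintype ι] [DecidableEq ι] {m : ι → Type*}
  [∀ i, Fintype (m i)] [∀ i, DecidableEq (m i)]

theorem coe_blockDiag (X : ∀ i, GL (m i) ℂ) :
    (blockDiag m X : Matrix (Σ i, m i) (Σ i, m i) ℂ)
      = Matrix.blockDiagonal' fun i => (X i : Matrix (m i) (m i) ℂ) := rfl

theorem blockDiag_injective : Function.Injective (blockDiag m) := by
  intro X Y h
  have h1 := congrArg Units.val h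
  rw [coe_blockDiag, coe_blockDiag, Matrix.blockDiagonal'_inj] at h1
  funext i
  exact Units.ext (congrFun h1 i)

theorem mem_blockProd {K : ∀ i, Subgroup (GL (m i) ℂ)} {g : GL (Σ i, m i) ℂ} :
    g ∈ blockProd K ↔ ∃ X : ∀ i, GL (m i) ℂ, (∀ i, X i ∈ K i) ∧ g = blockDiag m X := by
  simp only [blockProd, Subgroup.mem_map, Subgroup.mem_pi, Set.mem_univ, true_imp_iff]
  exact ⟨fun ⟨X, h, e⟩ => ⟨X, h, e.symm⟩, fun ⟨X, h, e⟩ => ⟨X, h, e.symm⟩⟩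

theorem blockDiag_mem_blockProd {K : ∀ i, Subgroup (GL (m i) ℂ)} {X : ∀ i, GL (m i) ℂ} :
    blockDiag m X ∈ blockProd K ↔ ∀ i, X i ∈ K i := by
  rw [mem_blockProd]
  refine ⟨?_, fun h => ⟨X, h, rfl⟩⟩
  rintro ⟨Y, hY, h⟩
  rwa [blockDiag_injective h]

theorem blockProd_inf_eq_bot {K L : ∀ i, Subgroup (GL (m i) ℂ)} (h : ∀ i, K i ⊓ L i = ⊥) :
    blockProd K ⊓ blockProd L = ⊥ := by
  rw [eq_bot_iff]
  rintro g ⟨hg, hg'⟩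
  obtain ⟨X, hX, rfl⟩ := mem_blockProd.1 hg
  replace hg' := blockDiag_mem_blockProd.1 hg'
  have : X = 1 := by
    funext i
    have h1 : X i ∈ K i ⊓ L i := ⟨hX i, hg' i⟩
    rwa [h i, Subgroup.mem_bot] at h1
  rw [this, map_one]
  exact one_mem _

theorem blockProd_conj_mem {K L : ∀ i, Subgroup (GL (m i) ℂ)}
    (h : ∀ i, ∀ g ∈ L i, ∀ x ∈ K i, g * x * g⁻¹ ∈ K i) {g x : GL (Σ i, m i) ℂ}
    (hg : g ∈ blockProd L) (hx : x ∈ blockProd K) : g * x * g⁻¹ ∈ blockProd K := by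
  obtain ⟨X, hX, rfl⟩ := mem_blockProd.1 hg
  obtain ⟨Y, hY, rfl⟩ := mem_blockProd.1 hx
  rw [← map_mul, ← map_inv, ← map_mul, blockDiag_mem_blockProd]
  exact fun i => h i _ (hX i) _ (hY i)

/-- The algebra of block diagonal matrices with blocks in given algebras. -/
def blockAlg (S : ∀ i, Subalgebra ℂ (Matrix (m i) (m i) ℂ)) :
    Subalgebra ℂ (Matrix (Σ i, m i) (Σ i, m i) ℂ) where
  carrier := {M | ∃ a : ∀ i, Matrix (m i) (m i) ℂ, (∀ i, a i ∈ S i) ∧ M = Matrix.blockDiagonal' a}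
  mul_mem' := by
    rintro _ _ ⟨a, ha, rfl⟩ ⟨b, hb, rfl⟩
    exact ⟨_, fun i => mul_mem (ha i) (hb i), (Matrix.blockDiagonal'_mul _ _).symm⟩
  add_mem' := by
    rintro _ _ ⟨a, ha, rfl⟩ ⟨b, hb, rfl⟩
    exact ⟨a + b, fun i => add_mem (ha i) (hb i), (Matrix.blockDiagonal'_add _ _).symm⟩
  algebraMap_mem' t := ⟨fun i => algebraMap ℂ _ t, fun i => (S i).algebraMap_mem t, by
    simp only [Algebra.algebraMap_eq_smul_one]
    rw [← Matrix.blockDiagonal'_one, ← Matrix.blockDiagonal'_smul]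
    rfl⟩

theorem mem_blockAlg {S : ∀ i, Subalgebra ℂ (Matrix (m i) (m i) ℂ)}
    {M : Matrix (Σ i, m i) (Σ i, m i) ℂ} :
    M ∈ blockAlg S ↔
      ∃ a : ∀ i, Matrix (m i) (m i) ℂ, (∀ i, a i ∈ S i) ∧ M = Matrix.blockDiagonal' a := Iff.rfl

theorem blockDiagonal'_mem_blockAlg {S : ∀ i, Subalgebra ℂ (Matrix (m i) (m i) ℂ)}
    {a : ∀ i, Matrix (m i) (m i) ℂ} : Matrix.blockDiagonal' a ∈ blockAlg S ↔ ∀ i, a i ∈ S i := by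
  refine ⟨?_, fun h => ⟨a, h, rfl⟩⟩
  rintro ⟨b, hb, h⟩
  rwa [Matrix.blockDiagonal'_inj.1 h]

/-- The algebra contains the projections onto the blocks, and commuting with these kills the
off-diagonal blocks. Elements supported in a single block then test the diagonal blocks one at a
time. -/
theorem centralizer_blockAlg (S : ∀ i, Subalgebra ℂ (Matrix (m i) (m i) ℂ)) :
    Subalgebra.centralizer ℂ (blockAlg S : Set (Matrix (Σ i, m i) (Σ i, m i) ℂ))
      = blockAlg fun i => Subalgebra.centralizer ℂ (S i : Set (Matrix (m i) (m i) ℂ)) := by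
  ext M
  rw [Subalgebra.mem_centralizer_iff]
  constructor
  · intro h
    have hM : M = Matrix.blockDiagonal' (Matrix.blockDiag' M) := by
      ext ⟨i, x⟩ ⟨j, y⟩
      by_cases hij : i = j
      · subst hij
        rw [Matrix.blockDiagonal'_apply_eq, Matrix.blockDiag'_apply]
      · rw [Matrix.blockDiagonal'_apply_ne _ _ _ hij]
        have h1 := congrFun (congrFun (h (Matrix.blockDiagonal' (Pi.single i 1))
          (blockDiagonal'_mem_blockAlg.2 (single_mem (one_mem _)))) ⟨i, x⟩) ⟨j, y⟩
        rw [Matrix.mul_apply, Matrix.mul_apply, Finset.sum_eq_single ⟨i, x⟩,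
          Finset.sum_eq_zero, Matrix.blockDiagonal'_apply_eq, Pi.single_eq_same,
          Matrix.one_apply_eq, one_mul] at h1
        · exact h1
        · rintro ⟨k, z⟩ _
          by_cases hk : k = j
          · subst hk
            rw [Matrix.blockDiagonal'_apply_eq, Pi.single_eq_of_ne (Ne.symm hij),
              Matrix.zero_apply, mul_zero]
          · rw [Matrix.blockDiagonal'_apply_ne _ _ _ hk, mul_zero]
        · rintro ⟨k, z⟩ _ hne
          by_cases hk : i = k
          · subst hk
            rw [Matrix.blockDiagonal'_apply_eq, Pi.single_eq_same, Matrix.one_apply_ne, zero_mul]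
            rintro rfl
            exact hne rfl
          · rw [Matrix.blockDiagonal'_apply_ne _ _ _ hk, zero_mul]
        · simp
    refine mem_blockAlg.2 ⟨Matrix.blockDiag' M, fun i => ?_, hM⟩
    rw [Subalgebra.mem_centralizer_iff]
    intro a ha
    have h1 := h (Matrix.blockDiagonal' (Pi.single i a))
      (blockDiagonal'_mem_blockAlg.2 (single_mem ha))
    rw [hM, ← Matrix.blockDiagonal'_mul, ← Matrix.blockDiagonal'_mul,
      Matrix.blockDiagonal'_inj] at h1
    simpa using congrFun h1 i
  · rintro ⟨b, hb, rfl⟩ _ ⟨a, ha, rfl⟩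
    rw [← Matrix.blockDiagonal'_mul, ← Matrix.blockDiagonal'_mul]
    congr 1
    funext i
    exact (Subalgebra.mem_centralizer_iff ℂ).1 (hb i) _ (ha i)

/-- A block diagonal invertible matrix is an element of the product of the general linear groups of
the blocks, if its blocks are allowed to vary in commutants. -/
theorem exists_eq_blockDiag {T : ∀ i, Set (Matrix (m i) (m i) ℂ)} {g : GL (Σ i, m i) ℂ}
    (hg : (g : Matrix (Σ i, m i) (Σ i, m i) ℂ)
      ∈ blockAlg fun i => Subalgebra.centralizer ℂ (T i)) :
    ∃ X : ∀ i, GL (m i) ℂ, (∀ i, (X i : Matrix (m i) (m i) ℂ) ∈ Subalgebra.centralizer ℂ (T i)) ∧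
      g = blockDiag m X := by
  obtain ⟨a, ha, h⟩ := hg
  have hu : ∀ i, IsUnit (a i) := by
    intro i
    have h1 := Units.mul_inv g
    rw [h] at h1
    -- The diagonal block of `g⁻¹` is a right inverse of `a i`, whether or not `g⁻¹` is known to be
    -- block diagonal; for square matrices a one-sided inverse is enough.
    refine IsUnit.of_mul_eq_one
      (Matrix.blockDiag' ((g⁻¹ : GL (Σ i, m i) ℂ) : Matrix (Σ i, m i) (Σ i, m i) ℂ) i) ?_
    ext x y
    have h2 := congrFun (congrFun h1 ⟨i, x⟩) ⟨i, y⟩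
    rw [Matrix.mul_apply, Fintype.sum_sigma, Finset.sum_eq_single i] at h2
    · simp only [Matrix.blockDiagonal'_apply_eq] at h2
      rw [Matrix.mul_apply]
      simp only [Matrix.blockDiag'_apply]
      rw [h2]
      simp [Matrix.one_apply]
    · intro k _ hk
      refine Finset.sum_eq_zero fun z _ => ?_
      rw [Matrix.blockDiagonal'_apply_ne _ _ _ (Ne.symm hk), zero_mul]
    · simp
  choose X hX using hu
  refine ⟨X, fun i => by rw [hX]; exact ha i, Units.ext ?_⟩
  rw [coe_blockDiag, h]
  simp only [hX]

/-- If the groups `K i` are the unit groups of commutants, then so is their product. -/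
theorem mem_blockProd_iff_mem_blockAlg {K : ∀ i, Subgroup (GL (m i) ℂ)}
    {T : ∀ i, Set (Matrix (m i) (m i) ℂ)}
    (h : ∀ i (x : GL (m i) ℂ), x ∈ K i ↔
      (x : Matrix (m i) (m i) ℂ) ∈ Subalgebra.centralizer ℂ (T i)) (g : GL (Σ i, m i) ℂ) :
    g ∈ blockProd K ↔ (g : Matrix (Σ i, m i) (Σ i, m i) ℂ)
      ∈ blockAlg fun i => Subalgebra.centralizer ℂ (T i) := by
  constructor
  · intro hg
    obtain ⟨X, hX, rfl⟩ := mem_blockProd.1 hg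
    rw [coe_blockDiag, blockDiagonal'_mem_blockAlg]
    exact fun i => (h i _).1 (hX i)
  · intro hg
    obtain ⟨X, hX, rfl⟩ := exists_eq_blockDiag hg
    exact blockDiag_mem_blockProd.2 fun i => (h i _).2 (hX i)

end BlockAlg

/-! ### Block permutation matrices -/

section BlockPerm

variable {p : ℕ} {m : Type*} [Fintype m] [DecidableEq m]

theorem coe_blockPerm_apply (σ : Equiv.Perm (Fin p)) (x y : Σ _ : Fin p, m) :
    (blockPerm p m σ : Matrix (Σ _ : Fin p, m) (Σ _ : Fin p, m) ℂ) x y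
      = if x.1 = σ y.1 ∧ x.2 = y.2 then 1 else 0 := rfl

theorem blockPerm_mul_blockDiagonal' (σ : Equiv.Perm (Fin p)) (X : Fin p → Matrix m m ℂ) :
    (blockPerm p m σ : Matrix (Σ _ : Fin p, m) (Σ _ : Fin p, m) ℂ) * Matrix.blockDiagonal' X
      = Matrix.blockDiagonal' (fun k => X (σ.symm k)) * blockPerm p m σ := by
  ext ⟨j, a⟩ ⟨k, b⟩
  rw [Matrix.mul_apply, Matrix.mul_apply, Finset.sum_eq_single ⟨σ.symm j, a⟩,
    Finset.sum_eq_single ⟨σ k, b⟩]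
  · rw [coe_blockPerm_apply, coe_blockPerm_apply, if_pos (by simp), if_pos (by simp), one_mul,
      mul_one]
    by_cases h : σ.symm j = k
    · subst h
      rw [Matrix.blockDiagonal'_apply_eq]
      simp only [Equiv.apply_symm_apply, Matrix.blockDiagonal'_apply_eq]
    · rw [Matrix.blockDiagonal'_apply_ne _ _ _ h, Matrix.blockDiagonal'_apply_ne]
      rintro rfl
      simp at h
  · rintro ⟨l, c⟩ _ hne
    rw [coe_blockPerm_apply, if_neg, mul_zero]
    rintro ⟨h1, h2⟩
    exact hne (by simp only at h1 h2; rw [h1, h2])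
  · simp
  · rintro ⟨l, c⟩ _ hne
    rw [coe_blockPerm_apply, if_neg, zero_mul]
    rintro ⟨h1, h2⟩
    refine hne ?_
    simp only at h1 h2
    rw [h1, h2, Equiv.symm_apply_apply]
  · simp

theorem blockPerm_conj_blockDiag (σ : Equiv.Perm (Fin p)) (X : Fin p → GL m ℂ) :
    blockPerm p m σ * blockDiag (fun _ => m) X * (blockPerm p m σ)⁻¹
      = blockDiag (fun _ => m) (fun k => X (σ.symm k)) := by
  rw [mul_inv_eq_iff_eq_mul]
  refine Units.ext ?_
  exact blockPerm_mul_blockDiagonal' σ fun k => (X k : Matrix m m ℂ)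

/-- If `σ k ≠ k`, the block `(σ k, k)` lies off the diagonal and equals the identity, which is
nonzero as `m` is nonempty. -/
theorem eq_one_of_blockPerm_eq_blockDiag [Nonempty m] {σ : Equiv.Perm (Fin p)} {X : Fin p → GL m ℂ}
    (h : blockPerm p m σ = blockDiag (fun _ => m) X) : σ = 1 := by
  ext k
  by_contra hk
  obtain ⟨a⟩ := ‹Nonempty m›
  have h0 : (blockPerm p m σ : Matrix (Σ _ : Fin p, m) (Σ _ : Fin p, m) ℂ)
      = (blockDiag (fun _ => m) X : GL (Σ _ : Fin p, m) ℂ) := by rw [h]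
  have h1 := congrFun (congrFun h0 ⟨σ k, a⟩) ⟨k, a⟩
  rw [coe_blockPerm_apply, if_pos ⟨rfl, rfl⟩, coe_blockDiag, Matrix.blockDiagonal'_apply_ne] at h1
  · exact one_ne_zero h1
  · intro h2
    exact hk (by rw [h2]; rfl)

theorem blockPerm_injective [Nonempty m] : Function.Injective (blockPerm p m) := by
  refine (injective_iff_map_eq_one (blockPerm p m)).2 fun σ h => ?_
  have h1 : blockDiag (fun _ : Fin p => m) 1 = 1 := map_one _
  exact eq_one_of_blockPerm_eq_blockDiag (h.trans h1.symm)

theorem blockPerm_conj_mem_blockProd (K : Subgroup (GL m ℂ)) {x g : GL (Σ _ : Fin p, m) ℂ}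
    (hg : g ∈ (blockPerm p m).range) (hx : x ∈ blockProd fun _ : Fin p => K) :
    g * x * g⁻¹ ∈ blockProd fun _ : Fin p => K := by
  obtain ⟨σ, rfl⟩ := hg
  obtain ⟨X, hX, rfl⟩ := mem_blockProd.1 hx
  rw [blockPerm_conj_blockDiag, blockDiag_mem_blockProd]
  exact fun k => hX _

end BlockPerm


/-! ### Semidirect products of subgroups -/

section Semidirect

variable {G : Type*} [Group G] {H K : Subgroup G}

theorem le_normalizer_of_conj_mem (h : ∀ g ∈ K, ∀ x ∈ H, g * x * g⁻¹ ∈ H) :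
    K ≤ Subgroup.normalizer (H : Set G) := by
  intro g hg
  rw [Subgroup.mem_normalizer_iff]
  refine fun x => ⟨h g hg x, fun hx => ?_⟩
  have := h g⁻¹ (inv_mem hg) _ hx
  simpa [mul_assoc] using this

theorem isSemidirect_sup (h : ∀ g ∈ K, ∀ x ∈ H, g * x * g⁻¹ ∈ H) (hHK : H ⊓ K = ⊥) :
    IsSemidirect (H ⊔ K) H K := by
  have hK := le_normalizer_of_conj_mem h
  have hmem : ∀ g ∈ H ⊔ K, ∃ x ∈ H, ∃ k ∈ K, g = x * k := by
    intro g hg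
    rw [← SetLike.mem_coe, Subgroup.coe_mul_of_right_le_normalizer_left H K hK] at hg
    obtain ⟨x, hx, k, hk, rfl⟩ := hg
    exact ⟨x, hx, k, hk, rfl⟩
  refine ⟨le_sup_left, le_sup_right, ?_, hHK, hmem⟩
  intro g hg x hx
  have h1 : g ∈ Subgroup.normalizer (H : Set G) := (sup_le Subgroup.le_normalizer hK) hg
  exact (Subgroup.mem_normalizer_iff.1 h1 x).1 hx

end Semidirect

/-! ### The subgroups attached to one part -/

section Part

variable {r n p : ℕ}

theorem weylPower_inf_permGroup (hr : 0 < r) (hn : 0 < n) :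
    weylPower r n p ⊓ permGroup r n p = ⊥ := by
  have : Nonempty (Fin n × Fin r) := ⟨(⟨0, hn⟩, ⟨0, hr⟩)⟩
  rw [eq_bot_iff]
  rintro g ⟨hg, σ, rfl⟩
  obtain ⟨X, -, hX⟩ := mem_blockProd.1 hg
  rw [eq_one_of_blockPerm_eq_blockDiag hX, map_one]
  exact one_mem _

theorem isSemidirect_weylPermGroup (hr : 0 < r) (hn : 0 < n) :
    IsSemidirect (weylPermGroup r n p) (weylPower r n p) (permGroup r n p) :=
  isSemidirect_sup (fun _ hg _ hx => blockPerm_conj_mem_blockProd (weylGroup r n) hg hx)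
    (weylPower_inf_permGroup hr hn)

theorem weylGroup_conj_jordanGroup {w x : GL (Fin n × Fin r) ℂ} (hw : w ∈ weylGroup r n)
    (hx : x ∈ jordanGroup r n) : w * x * w⁻¹ ∈ jordanGroup r n := by
  rw [mem_jordanGroup_iff] at hx ⊢
  exact weylGroup_conj_mem hw hx

theorem weylPermGroup_le_normalizer :
    weylPermGroup r n p ≤ Subgroup.normalizer (jordanPower r n p : Set (GL (PartIndex r n p) ℂ)) :=
  sup_le
    (le_normalizer_of_conj_mem fun _ hg _ hx =>
      blockProd_conj_mem (fun _ _ hw _ hx => weylGroup_conj_jordanGroup hw hx) hg hx)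
    (le_normalizer_of_conj_mem fun _ hg _ hx =>
      blockPerm_conj_mem_blockProd (jordanGroup r n) hg hx)

theorem jordanPower_inf_weylPermGroup (hr : 0 < r) (hn : 0 < n) :
    jordanPower r n p ⊓ weylPermGroup r n p = ⊥ := by
  have : Nonempty (Fin n × Fin r) := ⟨(⟨0, hn⟩, ⟨0, hr⟩)⟩
  rw [eq_bot_iff]
  rintro g ⟨hg, hg'⟩
  obtain ⟨w, hw, _, ⟨σ, rfl⟩, h⟩ := (isSemidirect_weylPermGroup hr hn).exists_mul g hg'
  obtain ⟨X, hX, rfl⟩ := mem_blockProd.1 hg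
  obtain ⟨Y, hY, rfl⟩ := mem_blockProd.1 hw
  have h1 : blockPerm p (Fin n × Fin r) σ = blockDiag (fun _ => Fin n × Fin r) (Y⁻¹ * X) := by
    rw [map_mul, map_inv, h, inv_mul_cancel_left]
  -- The permutation factor is block diagonal, hence trivial, and the claim reduces to single
  -- blocks.
  rw [eq_one_of_blockPerm_eq_blockDiag h1, map_one, mul_one] at h
  have h2 : blockProd (fun _ : Fin p => jordanGroup r n) ⊓ blockProd (fun _ => weylGroup r n) = ⊥ :=
    blockProd_inf_eq_bot fun _ => jordanGroup_inf_weylGroup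
  rw [← h2]
  exact ⟨hg, h ▸ hw⟩

end Part

/-! ### Matrices with two levels of blocks -/

section TwoLevel

variable {r s : ℕ} {n p : Fin s → ℕ}

/-- The block diagonal matrix with the blocks `z ℓ`. -/
noncomputable def diagHom (r : ℕ) {s : ℕ} (n p : Fin s → ℕ) :
    (∀ ℓ : (Σ i, Fin (p i)), Matrix (Fin (n ℓ.1) × Fin r) (Fin (n ℓ.1) × Fin r) ℂ) →+*
      Matrix (Index r n p) (Index r n p) ℂ where
  toFun z := Matrix.blockDiagonal' fun i => Matrix.blockDiagonal' fun k => z ⟨i, k⟩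
  map_one' := by
    refine Eq.trans ?_ Matrix.blockDiagonal'_one
    congr 1
    funext i
    exact Matrix.blockDiagonal'_one
  map_mul' z z' := by
    rw [← Matrix.blockDiagonal'_mul]
    congr 1
    funext i
    exact Matrix.blockDiagonal'_mul _ _
  map_zero' := by
    refine Eq.trans ?_ Matrix.blockDiagonal'_zero
    congr 1
    funext i
    exact Matrix.blockDiagonal'_zero
  map_add' z z' := by
    rw [← Matrix.blockDiagonal'_add]
    congr 1
    funext i
    exact Matrix.blockDiagonal'_add _ _

theorem diagHom_apply
    (z : ∀ ℓ : (Σ i, Fin (p i)), Matrix (Fin (n ℓ.1) × Fin r) (Fin (n ℓ.1) × Fin r) ℂ) :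
    diagHom r n p z
      = Matrix.blockDiagonal' fun i => Matrix.blockDiagonal' fun k => z ⟨i, k⟩ := rfl

theorem diagHom_injective : Function.Injective (diagHom r n p) := by
  intro z z' h
  rw [diagHom_apply, diagHom_apply, Matrix.blockDiagonal'_inj] at h
  funext ⟨i, k⟩
  exact congrFun (Matrix.blockDiagonal'_inj.1 (congrFun h i)) k

theorem trace_diagHom
    (z : ∀ ℓ : (Σ i, Fin (p i)), Matrix (Fin (n ℓ.1) × Fin r) (Fin (n ℓ.1) × Fin r) ℂ) :
    (diagHom r n p z).trace = ∑ ℓ, (z ℓ).trace := by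
  rw [diagHom_apply, Matrix.trace_blockDiagonal', Fintype.sum_sigma]
  exact Finset.sum_congr rfl fun i _ => Matrix.trace_blockDiagonal' _

theorem mem_blockAlg_blockAlg
    {S : ∀ i : Fin s, Subalgebra ℂ (Matrix (Fin (n i) × Fin r) (Fin (n i) × Fin r) ℂ)}
    {M : Matrix (Index r n p) (Index r n p) ℂ} :
    M ∈ blockAlg (fun i => blockAlg fun _ : Fin (p i) => S i)
      ↔ ∃ z, (∀ ℓ, z ℓ ∈ S ℓ.1) ∧ M = diagHom r n p z := by
  constructor
  · rintro ⟨a, ha, rfl⟩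
    choose b hb h using ha
    refine ⟨fun ℓ => b ℓ.1 ℓ.2, fun ℓ => hb _ _, ?_⟩
    rw [diagHom_apply]
    congr 1
    funext i
    exact h i
  · rintro ⟨z, hz, rfl⟩
    exact ⟨_, fun i => blockDiagonal'_mem_blockAlg.2 fun k => hz ⟨i, k⟩, rfl⟩

/-- The idempotent projecting onto the block `ℓ`. -/
noncomputable def blockIdem (r : ℕ) {s : ℕ} (n p : Fin s → ℕ) (ℓ : Σ i, Fin (p i)) :
    ∀ ℓ' : (Σ i, Fin (p i)), Matrix (Fin (n ℓ'.1) × Fin r) (Fin (n ℓ'.1) × Fin r) ℂ :=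
  fun ℓ' => if ℓ' = ℓ then 1 else 0

theorem blockIdem_mul_self (ℓ : Σ i, Fin (p i)) :
    blockIdem r n p ℓ * blockIdem r n p ℓ = blockIdem r n p ℓ := by
  funext ℓ'
  by_cases h : ℓ' = ℓ <;> simp [blockIdem, h]

theorem blockIdem_mul_of_ne {ℓ ℓ' : Σ i, Fin (p i)} (h : ℓ ≠ ℓ') :
    blockIdem r n p ℓ * blockIdem r n p ℓ' = 0 := by
  funext m
  simp only [blockIdem, Pi.mul_apply, Pi.zero_apply]
  split_ifs with h1 h2
  · exact absurd (h1.symm.trans h2) h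
  · rw [mul_zero]
  · rw [zero_mul]
  · rw [zero_mul]

theorem sum_blockIdem : ∑ ℓ, blockIdem r n p ℓ = 1 := by
  funext m
  rw [Finset.sum_apply]
  simp [blockIdem]

theorem trace_diagHom_blockIdem (ℓ : Σ i, Fin (p i)) :
    (diagHom r n p (blockIdem r n p ℓ)).trace = (n ℓ.1 * r : ℂ) := by
  rw [trace_diagHom, Finset.sum_eq_single ℓ]
  · simp [blockIdem]
  · intro m _ hm
    simp [blockIdem, hm]
  · simp

/-- The algebra spanned by `H_λ`. -/
noncomputable def hAlg (r : ℕ) {s : ℕ} (n p : Fin s → ℕ) :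
    Subalgebra ℂ (Matrix (Index r n p) (Index r n p) ℂ) :=
  blockAlg fun i => blockAlg fun _ : Fin (p i) => toeplitzAlg r (n i)

/-- The commutant of the algebra of all block Toeplitz matrices. -/
noncomputable def scalarAlg (r n : ℕ) : Subalgebra ℂ (Matrix (Fin n × Fin r) (Fin n × Fin r) ℂ) :=
  Subalgebra.centralizer ℂ (toeplitzAlg r n : Set (Matrix (Fin n × Fin r) (Fin n × Fin r) ℂ))

/-- The Toeplitz algebra is itself a commutant, so it coincides with its bicommutant. -/
theorem centralizer_scalarAlg (r n : ℕ) :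
    Subalgebra.centralizer ℂ (scalarAlg r n : Set (Matrix (Fin n × Fin r) (Fin n × Fin r) ℂ))
      = toeplitzAlg r n :=
  Subalgebra.centralizer_centralizer_centralizer ℂ

/-- Unit groups of commutants are compatible with block diagonal products. This is used at both
levels of blocks, the outer one requiring the algebra of each part to be exhibited as a commutant.
-/
theorem mem_hGroup_iff (g : GL (Index r n p) ℂ) :
    g ∈ hGroup r n p ↔ (g : Matrix (Index r n p) (Index r n p) ℂ) ∈ hAlg r n p := by
  let B : ∀ i, Subalgebra ℂ (Matrix (PartIndex r (n i) (p i)) (PartIndex r (n i) (p i)) ℂ) :=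
    fun i => blockAlg fun _ : Fin (p i) => scalarAlg r (n i)
  have h1 : ∀ i, blockAlg (fun _ : Fin (p i) => toeplitzAlg r (n i))
      = Subalgebra.centralizer ℂ
          (B i : Set (Matrix (PartIndex r (n i) (p i)) (PartIndex r (n i) (p i)) ℂ)) := by
    intro i
    rw [centralizer_blockAlg]
    simp only [centralizer_scalarAlg]
  have h2 : hAlg r n p = blockAlg fun i => Subalgebra.centralizer ℂ
      (B i : Set (Matrix (PartIndex r (n i) (p i)) (PartIndex r (n i) (p i)) ℂ)) := by
    rw [hAlg]
    congr 1
    funext i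
    exact h1 i
  rw [h2]
  refine mem_blockProd_iff_mem_blockAlg (fun i x => ?_) g
  rw [← h1]
  exact mem_blockProd_iff_mem_blockAlg (fun _ y => mem_jordanGroup_iff y) x

theorem conj_mem_hAlg {g : GL (Index r n p) ℂ}
    (hg : ∀ h ∈ hGroup r n p, g * h * g⁻¹ ∈ hGroup r n p)
    {a : Matrix (Index r n p) (Index r n p) ℂ} (ha : a ∈ hAlg r n p) :
    (g : Matrix (Index r n p) (Index r n p) ℂ) * a * (g⁻¹ : GL (Index r n p) ℂ) ∈ hAlg r n p :=
  conj_mem_of_units (fun u hu => (mem_hGroup_iff _).1 (hg u ((mem_hGroup_iff u).2 hu))) ha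

theorem mem_normalizer_hGroup_iff (g : GL (Index r n p) ℂ) :
    g ∈ Subgroup.normalizer (hGroup r n p : Set (GL (Index r n p) ℂ)) ↔
      ∀ h ∈ hGroup r n p, g * h * g⁻¹ ∈ hGroup r n p := by
  rw [Subgroup.mem_normalizer_iff]
  refine ⟨fun hg h hh => (hg h).1 hh, fun hg h => ⟨hg h, fun hh => ?_⟩⟩
  rw [mem_hGroup_iff] at hh ⊢
  have h1 := inv_conj_mem (fun _ ha => conj_mem_hAlg hg ha) hh
  rw [Units.val_mul, Units.val_mul, mul_assoc, Units.inv_mul_cancel_right,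
    Units.inv_mul_cancel_left] at h1
  exact h1

theorem mem_centralizer_hAlg {M : Matrix (Index r n p) (Index r n p) ℂ} :
    M ∈ Subalgebra.centralizer ℂ (hAlg r n p : Set (Matrix (Index r n p) (Index r n p) ℂ)) ↔
      ∃ z, (∀ ℓ, z ℓ ∈ scalarAlg r (n ℓ.1)) ∧ M = diagHom r n p z := by
  rw [hAlg, centralizer_blockAlg]
  simp only [centralizer_blockAlg]
  exact mem_blockAlg_blockAlg

/-! ### Permutation of the diagonal blocks -/

/-- A matrix normalizing `H_λ` permutes the idempotents that project onto the blocks. -/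
theorem exists_perm_blockIdem (hr : 0 < r) (hn0 : ∀ i, 0 < n i) {g : GL (Index r n p) ℂ}
    (hg : ∀ h ∈ hGroup r n p, g * h * g⁻¹ ∈ hGroup r n p) :
    ∃ π : Equiv.Perm (Σ i, Fin (p i)), ∀ ℓ,
      (g : Matrix (Index r n p) (Index r n p) ℂ) * diagHom r n p (blockIdem r n p ℓ)
        * (g⁻¹ : GL (Index r n p) ℂ) = diagHom r n p (blockIdem r n p (π ℓ)) := by
  have hne : ∀ i, (1 : Matrix (Fin (n i) × Fin r) (Fin (n i) × Fin r) ℂ) ≠ 0 := by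
    intro i h
    have := congrFun (congrFun h (⟨0, hn0 i⟩, ⟨0, hr⟩)) (⟨0, hn0 i⟩, ⟨0, hr⟩)
    simp at this
  have hE : ∀ ℓ, ∃ z, (∀ m, z m ∈ scalarAlg r (n m.1)) ∧
      (g : Matrix (Index r n p) (Index r n p) ℂ) * diagHom r n p (blockIdem r n p ℓ)
        * (g⁻¹ : GL (Index r n p) ℂ) = diagHom r n p z := by
    intro ℓ
    refine mem_centralizer_hAlg.1 (conj_mem_centralizer (fun a ha => conj_mem_hAlg hg ha) ?_)
    refine mem_centralizer_hAlg.2 ⟨_, fun m => ?_, rfl⟩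
    rw [blockIdem]
    split_ifs
    · exact one_mem _
    · exact zero_mem _
  choose f hfc hf using hE
  have hmul : ∀ ℓ ℓ', diagHom r n p (f ℓ * f ℓ')
      = (g : Matrix (Index r n p) (Index r n p) ℂ)
        * diagHom r n p (blockIdem r n p ℓ * blockIdem r n p ℓ') * (g⁻¹ : GL (Index r n p) ℂ) := by
    intro ℓ ℓ'
    rw [map_mul, map_mul, ← hf, ← hf]
    simp only [mul_assoc, Units.inv_mul_cancel_left]
  have hidem : ∀ ℓ, f ℓ * f ℓ = f ℓ := fun ℓ =>
    diagHom_injective (by rw [hmul, blockIdem_mul_self, hf])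
  have horth : ∀ ℓ ℓ', ℓ ≠ ℓ' → f ℓ * f ℓ' = 0 := fun ℓ ℓ' h =>
    diagHom_injective (by rw [hmul, blockIdem_mul_of_ne h, map_zero, mul_zero, zero_mul])
  have hsum : ∑ ℓ, f ℓ = 1 := by
    refine diagHom_injective ?_
    rw [map_sum, map_one, ← Finset.sum_congr rfl fun ℓ _ => hf ℓ, ← Finset.sum_mul,
      ← Finset.mul_sum, ← map_sum, sum_blockIdem, map_one, mul_one, Units.mul_inv]
  -- Each component is an idempotent of the local ring ℂ[X]/(X^n).
  have h01 : ∀ ℓ m, f ℓ m = 0 ∨ f ℓ m = 1 := by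
    intro ℓ m
    obtain ⟨q, hq⟩ := exists_eq_scalarToeplitz (hfc ℓ m)
    rw [hq]
    refine scalarToeplitz_eq_zero_or_one_of_idempotent hr (hn0 _) ?_
    rw [← hq]
    exact congrFun (hidem ℓ) m
  have hex : ∀ m, ∃ ℓ, f ℓ m = 1 := by
    intro m
    by_contra! h
    have h1 := congrFun hsum m
    rw [Finset.sum_apply, Finset.sum_eq_zero fun ℓ _ => (h01 ℓ m).resolve_right (h ℓ)] at h1
    exact hne _ h1.symm
  -- `τ m` is the index of the conjugated idempotent that is 1 on block `m`; it is unique by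
  -- orthogonality. As no conjugated idempotent is 0, `τ` is onto, hence bijective, and the required
  -- permutation is its inverse.
  choose τ hτ using hex
  have hτ' : ∀ ℓ m, ℓ ≠ τ m → f ℓ m = 0 := by
    intro ℓ m h
    have h1 := congrFun (horth ℓ (τ m) h) m
    rwa [Pi.mul_apply, hτ, mul_one] at h1
  have hsurj : Function.Surjective τ := by
    intro ℓ
    by_contra! h
    have h0 : f ℓ = 0 := funext fun m => hτ' ℓ m (h m).symm
    have h1 := hf ℓ
    rw [h0, map_zero, Units.mul_left_eq_zero, Units.mul_right_eq_zero] at h1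
    have h2 := congrFun (diagHom_injective (h1.trans (map_zero _).symm)) ℓ
    rw [blockIdem, if_pos rfl] at h2
    exact hne _ h2
  have hbij : Function.Bijective τ := Finite.surjective_iff_bijective.1 hsurj
  refine ⟨(Equiv.ofBijective τ hbij).symm, fun ℓ => ?_⟩
  rw [hf]
  congr 1
  funext m
  rw [blockIdem]
  split_ifs with h
  · have h1 : τ m = ℓ := by
      rw [h]
      exact (Equiv.ofBijective τ hbij).apply_symm_apply ℓ
    rw [← h1, hτ]
  · refine hτ' _ _ fun h1 => h ?_
    rw [h1]
    exact ((Equiv.ofBijective τ hbij).symm_apply_apply m).symm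

/-- A permutation of the blocks that preserves the sizes is given by permutations of the blocks of
equal size. -/
theorem exists_perm_of_fst_eq {π : Equiv.Perm (Σ i, Fin (p i))} (h : ∀ ℓ, (π ℓ).1 = ℓ.1) :
    ∃ σ : ∀ i, Equiv.Perm (Fin (p i)), ∀ i k, π ⟨i, k⟩ = ⟨i, σ i k⟩ := by
  have h1 : ∀ i (k : Fin (p i)), ∃ l : Fin (p i), π ⟨i, k⟩ = ⟨i, l⟩ := by
    intro i k
    have h2 := h ⟨i, k⟩
    generalize π ⟨i, k⟩ = x at h2
    obtain ⟨j, l⟩ := x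
    obtain rfl : j = i := h2
    exact ⟨l, rfl⟩
  choose σ hσ using h1
  have hinj : ∀ i, Function.Injective (σ i) := by
    intro i k l hkl
    have h2 : π ⟨i, k⟩ = π ⟨i, l⟩ := by rw [hσ, hσ, hkl]
    simpa using π.injective h2
  exact ⟨fun i => Equiv.ofBijective (σ i) (Finite.injective_iff_bijective.1 (hinj i)), hσ⟩

/-- The block permutation matrix attached to permutations of the blocks of equal size. -/
noncomputable def permMatrix (r : ℕ) {s : ℕ} (n p : Fin s → ℕ) (σ : ∀ i, Equiv.Perm (Fin (p i))) :
    GL (Index r n p) ℂ :=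
  blockDiag (fun i => PartIndex r (n i) (p i)) fun i => blockPerm (p i) (Fin (n i) × Fin r) (σ i)

theorem permMatrix_mul_diagHom (σ : ∀ i, Equiv.Perm (Fin (p i)))
    (z : ∀ ℓ : (Σ i, Fin (p i)), Matrix (Fin (n ℓ.1) × Fin r) (Fin (n ℓ.1) × Fin r) ℂ) :
    (permMatrix r n p σ : Matrix (Index r n p) (Index r n p) ℂ) * diagHom r n p z
      = diagHom r n p (fun ℓ => z ⟨ℓ.1, (σ ℓ.1).symm ℓ.2⟩) * permMatrix r n p σ := by
  rw [permMatrix, coe_blockDiag, diagHom_apply, diagHom_apply, ← Matrix.blockDiagonal'_mul,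
    ← Matrix.blockDiagonal'_mul]
  congr 1
  funext i
  exact blockPerm_mul_blockDiagonal' (m := Fin (n i) × Fin r) (σ i) fun k => z ⟨i, k⟩

theorem permMatrix_mul_blockIdem {π : Equiv.Perm (Σ i, Fin (p i))}
    {σ : ∀ i, Equiv.Perm (Fin (p i))} (h : ∀ i k, π ⟨i, k⟩ = ⟨i, σ i k⟩) (ℓ : Σ i, Fin (p i)) :
    (permMatrix r n p σ : Matrix (Index r n p) (Index r n p) ℂ)
        * diagHom r n p (blockIdem r n p ℓ)
      = diagHom r n p (blockIdem r n p (π ℓ)) * permMatrix r n p σ := by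
  rw [permMatrix_mul_diagHom]
  congr 2
  funext ⟨i, k⟩
  have h1 : (⟨i, k⟩ : Σ i, Fin (p i)) = π ⟨i, (σ i).symm k⟩ := by
    rw [h, Equiv.apply_symm_apply]
  have h2 : (⟨i, (σ i).symm k⟩ : Σ i, Fin (p i)) = ℓ ↔ (⟨i, k⟩ : Σ i, Fin (p i)) = π ℓ :=
    ⟨fun h3 => h1.trans (congrArg π h3), fun h3 => π.injective (h1.symm.trans h3)⟩
  simp only [blockIdem, h2]

theorem permMatrix_mem (σ : ∀ i, Equiv.Perm (Fin (p i))) :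
    permMatrix r n p σ ∈ blockProd fun i => weylPermGroup r (n i) (p i) :=
  blockDiag_mem_blockProd.2 fun i => Subgroup.mem_sup_right ⟨σ i, rfl⟩

theorem blockProd_weylPermGroup_le_normalizer :
    blockProd (fun i => weylPermGroup r (n i) (p i))
      ≤ Subgroup.normalizer (hGroup r n p : Set (GL (Index r n p) ℂ)) :=
  le_normalizer_of_conj_mem fun _ hg _ hx =>
    blockProd_conj_mem (fun _ _ hw x hx =>
      (Subgroup.mem_normalizer_iff.1 (weylPermGroup_le_normalizer hw) x).1 hx) hg hx

/-- An invertible matrix commuting with the block idempotents is block diagonal. -/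
theorem exists_eq_blockDiag_of_commute {g : GL (Index r n p) ℂ}
    (hg : ∀ ℓ, (g : Matrix (Index r n p) (Index r n p) ℂ) * diagHom r n p (blockIdem r n p ℓ)
      = diagHom r n p (blockIdem r n p ℓ) * g) :
    ∃ X : ∀ i, Fin (p i) → GL (Fin (n i) × Fin r) ℂ,
      g = blockDiag (fun i => PartIndex r (n i) (p i))
        fun i => blockDiag (fun _ => Fin (n i) × Fin r) (X i) := by
  -- The idempotents span the algebra of matrices that are scalar on each block, so
  -- `centralizer_blockAlg`, applied at both levels, shows `g` to be block diagonal.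
  have h1 : (g : Matrix (Index r n p) (Index r n p) ℂ) ∈ Subalgebra.centralizer ℂ
      (blockAlg (fun i => blockAlg fun _ : Fin (p i) =>
        (⊥ : Subalgebra ℂ (Matrix (Fin (n i) × Fin r) (Fin (n i) × Fin r) ℂ))) :
          Set (Matrix (Index r n p) (Index r n p) ℂ)) := by
    rw [Subalgebra.mem_centralizer_iff]
    intro M hM
    obtain ⟨z, hz, rfl⟩ := mem_blockAlg_blockAlg.1 hM
    have hz' : ∀ ℓ, ∃ t : ℂ, algebraMap ℂ _ t = z ℓ := fun ℓ => Algebra.mem_bot.1 (hz ℓ)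
    choose t ht using hz'
    have h2 : diagHom r n p z = ∑ ℓ, t ℓ • diagHom r n p (blockIdem r n p ℓ) := by
      have h3 : ∀ ℓ, t ℓ • diagHom r n p (blockIdem r n p ℓ)
          = diagHom r n p (t ℓ • blockIdem r n p ℓ) := by
        intro ℓ
        rw [diagHom_apply, ← Matrix.blockDiagonal'_smul, diagHom_apply]
        congr 1
        funext i
        exact (Matrix.blockDiagonal'_smul (t ℓ) fun k => blockIdem r n p ℓ ⟨i, k⟩).symm
      rw [Finset.sum_congr rfl fun ℓ _ => h3 ℓ, ← map_sum]
      congr 1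
      funext m
      rw [Finset.sum_apply, ← ht, Algebra.algebraMap_eq_smul_one]
      simp [blockIdem]
    rw [h2, Finset.sum_mul, Finset.mul_sum]
    refine Finset.sum_congr rfl fun ℓ _ => ?_
    rw [smul_mul_assoc, mul_smul_comm, hg]
  rw [centralizer_blockAlg] at h1
  obtain ⟨Y, hY, rfl⟩ := exists_eq_blockDiag h1
  have h2 : ∀ i, ∃ X : Fin (p i) → GL (Fin (n i) × Fin r) ℂ,
      Y i = blockDiag (fun _ => Fin (n i) × Fin r) X := by
    intro i
    have h3 := hY i
    rw [centralizer_blockAlg] at h3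
    obtain ⟨X, -, hX⟩ := exists_eq_blockDiag h3
    exact ⟨X, hX⟩
  choose X hX using h2
  exact ⟨X, by congr 1; funext i; exact hX i⟩

/-- The blocks of a block diagonal matrix normalizing `H_λ` normalize the Toeplitz algebras. -/
theorem conj_mem_toeplitzAlg_of_blockDiag {X : ∀ i, Fin (p i) → GL (Fin (n i) × Fin r) ℂ}
    (hX : ∀ h ∈ hGroup r n p,
      (blockDiag (fun i => PartIndex r (n i) (p i))
        fun i => blockDiag (fun _ => Fin (n i) × Fin r) (X i)) * h *
      (blockDiag (fun i => PartIndex r (n i) (p i))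
        fun i => blockDiag (fun _ => Fin (n i) × Fin r) (X i))⁻¹ ∈ hGroup r n p)
    (i : Fin s) (k : Fin (p i)) {a : Matrix (Fin (n i) × Fin r) (Fin (n i) × Fin r) ℂ}
    (ha : a ∈ toeplitzAlg r (n i)) :
    (X i k : Matrix (Fin (n i) × Fin r) (Fin (n i) × Fin r) ℂ) * a
      * ((X i k)⁻¹ : GL (Fin (n i) × Fin r) ℂ) ∈ toeplitzAlg r (n i) := by
  set z : ∀ ℓ : (Σ i, Fin (p i)), Matrix (Fin (n ℓ.1) × Fin r) (Fin (n ℓ.1) × Fin r) ℂ :=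
    Pi.single ⟨i, k⟩ a with hz
  have h1 : diagHom r n p z ∈ hAlg r n p :=
    mem_blockAlg_blockAlg.2 ⟨z, fun ℓ => by
      by_cases h : ℓ = ⟨i, k⟩
      · subst h
        rwa [hz, Pi.single_eq_same]
      · rw [hz, Pi.single_eq_of_ne h]
        exact zero_mem _, rfl⟩
  have h2 := conj_mem_hAlg hX h1
  rw [← map_inv] at h2
  have h3 : ∀ Y : ∀ i, Fin (p i) → GL (Fin (n i) × Fin r) ℂ,
      ((blockDiag (fun i => PartIndex r (n i) (p i))
        fun i => blockDiag (fun _ => Fin (n i) × Fin r) (Y i) : GL (Index r n p) ℂ) :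
          Matrix (Index r n p) (Index r n p) ℂ)
      = diagHom r n p fun ℓ => Y ℓ.1 ℓ.2 := fun Y => rfl
  have h4 : (fun i => blockDiag (fun _ : Fin (p i) => Fin (n i) × Fin r) (X i))⁻¹
      = fun i => blockDiag (fun _ : Fin (p i) => Fin (n i) × Fin r) ((X i)⁻¹) := by
    funext i
    rw [map_inv]
    rfl
  rw [h4, h3, h3, ← map_mul, ← map_mul] at h2
  obtain ⟨b, hb, h5⟩ := mem_blockAlg_blockAlg.1 h2
  have h6 := congrFun (diagHom_injective h5) ⟨i, k⟩
  simp only [Pi.mul_apply, hz, Pi.single_eq_same] at h6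
  have h7 := hb ⟨i, k⟩
  rw [← h6] at h7
  exact h7

theorem exists_hGroup_mul (hr : 0 < r) (hn : StrictAnti n) (hn0 : ∀ i, 0 < n i)
    {g : GL (Index r n p) ℂ} (hg : ∀ h ∈ hGroup r n p, g * h * g⁻¹ ∈ hGroup r n p) :
    ∃ h ∈ hGroup r n p, ∃ k ∈ blockProd (fun i => weylPermGroup r (n i) (p i)), g = h * k := by
  obtain ⟨π, hπ⟩ := exists_perm_blockIdem hr hn0 hg
  have hfst : ∀ ℓ, (π ℓ).1 = ℓ.1 := by
    intro ℓ
    -- Conjugation preserves the trace `n_i r` of a block projection, and `n` is injective.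
    have h1 := congrArg Matrix.trace (hπ ℓ)
    rw [Matrix.trace_units_conj, trace_diagHom_blockIdem, trace_diagHom_blockIdem] at h1
    have h2 : n ℓ.1 * r = n (π ℓ).1 * r := by exact_mod_cast h1
    exact (hn.injective (Nat.eq_of_mul_eq_mul_right hr h2)).symm
  obtain ⟨σ, hσ⟩ := exists_perm_of_fst_eq hfst
  set P := permMatrix r n p σ with hP
  have hPn : P ∈ Subgroup.normalizer (hGroup r n p : Set (GL (Index r n p) ℂ)) :=
    blockProd_weylPermGroup_le_normalizer (permMatrix_mem σ)
  have hgn := (mem_normalizer_hGroup_iff g).2 hg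
  have hcomm : ∀ ℓ, ((P⁻¹ * g : GL (Index r n p) ℂ) : Matrix (Index r n p) (Index r n p) ℂ)
      * diagHom r n p (blockIdem r n p ℓ) = diagHom r n p (blockIdem r n p ℓ)
        * (P⁻¹ * g : GL (Index r n p) ℂ) := by
    intro ℓ
    have h1 := hπ ℓ
    rw [Units.mul_inv_eq_iff_eq_mul] at h1
    have h2 := permMatrix_mul_blockIdem (r := r) (n := n) hσ ℓ
    rw [Units.val_mul, mul_assoc, h1, Units.inv_mul_eq_iff_eq_mul, ← mul_assoc, ← mul_assoc, h2,
      mul_assoc _ (P : Matrix (Index r n p) (Index r n p) ℂ), Units.mul_inv, mul_one]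
  obtain ⟨X, hX⟩ := exists_eq_blockDiag_of_commute hcomm
  have hXn := (mem_normalizer_hGroup_iff _).1 (mul_mem (inv_mem hPn) hgn)
  rw [hX] at hXn
  have hdec : ∀ i k, ∃ h ∈ jordanGroup r (n i), ∃ w ∈ weylGroup r (n i), X i k = h * w :=
    fun i k => exists_jordanGroup_mul_weylGroup hr (hn0 i) (X i k) fun a ha =>
      conj_mem_toeplitzAlg_of_blockDiag hXn i k ha
  choose h hh w hw hhw using hdec
  set H : GL (Index r n p) ℂ := blockDiag (fun i => PartIndex r (n i) (p i))
    fun i => blockDiag (fun _ => Fin (n i) × Fin r) (h i) with hH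
  set W : GL (Index r n p) ℂ := blockDiag (fun i => PartIndex r (n i) (p i))
    fun i => blockDiag (fun _ => Fin (n i) × Fin r) (w i) with hW
  have hHW : P⁻¹ * g = H * W := by
    rw [hX, hH, hW, ← map_mul]
    congr 1
    funext i
    rw [Pi.mul_apply, ← map_mul]
    congr 1
    funext k
    exact hhw i k
  have hHmem : H ∈ hGroup r n p :=
    blockDiag_mem_blockProd.2 fun i => blockDiag_mem_blockProd.2 fun k => hh i k
  have hWmem : W ∈ blockProd fun i => weylPermGroup r (n i) (p i) :=
    blockDiag_mem_blockProd.2 fun i =>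
      Subgroup.mem_sup_left (blockDiag_mem_blockProd.2 fun k => hw i k)
  -- From `P⁻¹ g = H W`, moving `P` past `H` gives `g = (P H P⁻¹)(P W)`, and `P` normalizes `H_λ`.
  refine ⟨P * H * P⁻¹, (Subgroup.mem_normalizer_iff.1 hPn H).1 hHmem, P * W,
    mul_mem (permMatrix_mem σ) hWmem, ?_⟩
  rw [inv_mul_eq_iff_eq_mul] at hHW
  rw [hHW]
  group

end TwoLevel

end JordanNormalizer

/-! ### The structure of the normalizer -/

open JordanNormalizer in
theorem theorem3p9 (r s : ℕ) (hr : 0 < r) (n p : Fin s → ℕ) (hn : StrictAnti n)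
    (hn0 : ∀ i, 0 < n i) (hp0 : ∀ i, 0 < p i) :
    -- the normalizer is described by the one-sided condition
    (∀ g : GL (Index r n p) ℂ, g ∈ Subgroup.normalizer (hGroup r n p : Set (GL (Index r n p) ℂ)) ↔
      ∀ h ∈ hGroup r n p, g * h * g⁻¹ ∈ hGroup r n p) ∧
    -- the normalizer is the semidirect product of `H_λ` and a product of groups over `i`,
    IsSemidirect (Subgroup.normalizer (hGroup r n p : Set (GL (Index r n p) ℂ)))
      (hGroup r n p) (blockProd fun i => weylPermGroup r (n i) (p i)) ∧
    -- the `i`-th of which is the semidirect product of `W_r(n_i)^{p_i}` and the block permutations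
    (∀ i, IsSemidirect (weylPermGroup r (n i) (p i))
      (weylPower r (n i) (p i)) (permGroup r (n i) (p i))) ∧
    -- the group of block permutation matrices is isomorphic to the symmetric group
    (∀ i, Function.Injective (blockPerm (p i) (Fin (n i) × Fin r))) ∧
    -- it acts on `W_r(n_i)^{p_i}` by permuting the diagonal blocks
    (∀ i (σ : Equiv.Perm (Fin (p i))) (X : Fin (p i) → GL (Fin (n i) × Fin r) ℂ),
      (∀ k, X k ∈ weylGroup r (n i)) →
      blockPerm (p i) (Fin (n i) × Fin r) σ * blockDiag (fun _ => Fin (n i) × Fin r) X *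
          (blockPerm (p i) (Fin (n i) × Fin r) σ)⁻¹
        = blockDiag (fun _ => Fin (n i) × Fin r) (fun k => X (σ.symm k))) := by 
  have hne : ∀ i, Nonempty (Fin (n i) × Fin r) := fun i => ⟨(⟨0, hn0 i⟩, ⟨0, hr⟩)⟩
  refine ⟨mem_normalizer_hGroup_iff, ⟨Subgroup.le_normalizer, blockProd_weylPermGroup_le_normalizer,
    fun g hg => (mem_normalizer_hGroup_iff g).1 hg,
    blockProd_inf_eq_bot fun i => jordanPower_inf_weylPermGroup hr (hn0 i),
    fun g hg => exists_hGroup_mul hr hn hn0 ((mem_normalizer_hGroup_iff g).1 hg)⟩,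
    fun i => isSemidirect_weylPermGroup hr (hn0 i), fun i => blockPerm_injective,
    fun i σ X _ => blockPerm_conj_blockDiag σ X⟩
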